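/- Let $d\ge 2$, let $\Omega\subset\mathbb R^d$ be a bounded connected open set, and let $a\in L^\infty(\Omega)$ with $a\ge 0$. Let $V=\{u\in H^1_0(\Omega)^d:\operatorname{div}u=0\}$ and $H=\{u\in L^2(\Omega)^d:\operatorname{div}u=0,\ u\cdot\nu|_{\partial\Omega}=0\}$, the two conditions in $H$ being understood weakly, i.e. $\int_\Omega u\cdot\nabla p\,dx=0$ for all $p\in H^1(\Omega)$. Consider the damped hyperbolic Stokes system $$\partial_t^2u-\Delta u+\nabla p+a(x)\partial_tu=0,\qquad \operatorname{div}u=0\ \text{ in }\mathbb R\times\Omega,\qquad u=0\ \text{ on }\mathbb R\times\partial\Omega, \tag{D}$$ and the undamped system (U), which is (D) with $a$ replaced by $0$. Put $$E[u](t)=\frac12\int_\Omega\big(|\partial_tu(t,x)|^2+|\nabla u(t,x)|^2\big)\,dx,\qquad D[u](T)=\int_0^T\!\!\int_\Omega a(x)|\partial_tu(t,x)|^2\,dx\,dt .$$ For a class $\mathcal S$ of functions, consider the two assertions 1. (Stabilization) there are $C_0,\alpha>0$ such that $E[u](t)\le C_0E[u](0)e^{-\alpha t}$ for all $t\ge0$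 and every solution $u\in\mathcal S$ of the damped system (D); 2. (Observability) there are $C>0$ and $T>0$ such that $E[v](0)\le C\,D[v](T)$ for every solution $v\in\mathcal S$ of the undamped system (U). Then: (i) (strong solutions) suppose that $\Omega$ is regular enough for the Stokes operator to have its usual domain $V\cap H^2(\Omega)^d$, in the following sense: whenever $u\in V$ and $f\in L^2(\Omega)^d$ satisfy $\int_\Omega\nabla u:\nabla w\,dx=\int_\Omega f\cdot w\,dx$ for all $w\in V$, then $u\in H^2(\Omega)^d$ and $-\Delta u+\nabla p=f$ for some $p\in H^1(\Omega)$ (this holds, for instance, when $\partial\Omega$ is of class $C^2$). Then 1 and 2 are equivalent for $\mathcal S=C(\mathbb R;V\cap H^2(\Omega)^d)\cap C^1(\mathbb R;V)$, where the equation holds in $L^2(\Omega)^d$ at every time $t$, for some pressure $p(t)\in H^1(\Omega)$; (ii) (finite energy solutions) without any regularity assumption on $\partial\Omega$, 1 and 2 are equivalent for $\mathcal S=C(\mathbb R;V)\cap C^1(\mathbb R;H)$, where the equation is understood in the weak sense $$\frac{d}{dt}\int_\Omega\partial_tu\cdot w\,dx+\int_\Omega\nabla u:\nabla w\,dx+\int_\Omega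 a\,\partial_tu\cdot w\,dx=0\qquad\text{for all } w\in V .$$ -/

import Mathlib

open MeasureTheory Set Topology
open scoped ContDiff ENNReal

noncomputable section

namespace HypStokes

/-- The ambient Euclidean space `ℝᵈ`. -/
abbrev Rd (d : ℕ) : Type := EuclideanSpace ℝ (Fin d)

/-- The `i`-th standard basis vector of `ℝᵈ`. -/
abbrev e {d : ℕ} (i : Fin d) : Rd d := EuclideanSpace.single i (1 : ℝ)

/-- `L²(Ω)ᵈ`, the square integrable vector fields on `Ω`, with its Hilbert norm. -/
abbrev L2 {d : ℕ} (Ω : Set (Rd d)) : Type := Lp (Rd d) 2 (volume.restrict Ω)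

/-- `L²(Ω)`, the square integrable scalar functions on `Ω`. -/
abbrev L2s {d : ℕ} (Ω : Set (Rd d)) : Type := Lp ℝ 2 (volume.restrict Ω)

/-- `g` is the weak (distributional) partial derivative `∂ᵢ f` on `Ω`. It is only used for
`f`, `g` square integrable on `Ω`. -/
def HasWeakPartial {d : ℕ} {F : Type*} [NormedAddCommGroup F] [NormedSpace ℝ F]
    (Ω : Set (Rd d)) (i : Fin d) (f g : Rd d → F) : Prop :=
  ∀ φ : Rd d → ℝ, ContDiff ℝ ∞ φ → HasCompactSupport φ → tsupport φ ⊆ Ω →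
    ∫ x in Ω, (fderiv ℝ φ x (e i)) • f x = - ∫ x in Ω, φ x • g x

/-- `p ∈ H¹(Ω)` (scalar), with weak gradient `G ∈ L²(Ω)ᵈ`. -/
def HasWeakGradient {d : ℕ} (Ω : Set (Rd d)) (p : L2s Ω) (G : L2 Ω) : Prop :=
  ∀ i : Fin d, HasWeakPartial Ω i (fun x => p x) (fun x => G x i)

/-- Pairs `(u, (∂ᵢ u)ᵢ)` of a vector field and its partial derivatives, all in `L²(Ω)ᵈ`.
The product norm induces on the graph of the weak gradient the topology of `H¹(Ω)ᵈ`. -/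
abbrev Jet {d : ℕ} (Ω : Set (Rd d)) : Type := L2 Ω × (Fin d → L2 Ω)

/-- The first order jets `(φ, (∂ᵢ φ)ᵢ)` of the smooth vector fields `φ` compactly supported
in `Ω`. -/
def testJets {d : ℕ} (Ω : Set (Rd d)) : Set (Jet Ω) :=
  {j | ∃ φ : Rd d → Rd d, ContDiff ℝ ∞ φ ∧ HasCompactSupport φ ∧ tsupport φ ⊆ Ω ∧
    (∀ᵐ x ∂(volume.restrict Ω), j.1 x = φ x) ∧
    ∀ i : Fin d, ∀ᵐ x ∂(volume.restrict Ω), j.2 i x = fderiv ℝ φ x (e i)}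

/-- `H¹₀(Ω)ᵈ`, the closure of the test fields in `H¹(Ω)ᵈ` (an element is a field together with
its partial derivatives). The test jets already form a linear subspace, so the span adds
nothing. -/
def H10 {d : ℕ} (Ω : Set (Rd d)) : Submodule ℝ (Jet Ω) :=
  (Submodule.span ℝ (testJets Ω)).topologicalClosure

/-- The divergence-free condition `∑ᵢ ∂ᵢ uᵢ = 0` almost everywhere in `Ω`. -/
def divFree {d : ℕ} (Ω : Set (Rd d)) : Submodule ℝ (Jet Ω) where
  carrier := {j | ∀ᵐ x ∂(volume.restrict Ω), ∑ i : Fin d, (j.2 i x) i = 0}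
  zero_mem' := by
    change ∀ᵐ x ∂(volume.restrict Ω), ∑ i : Fin d, ((0 : L2 Ω) x) i = 0
    filter_upwards [Lp.coeFn_zero (Rd d) 2 (volume.restrict Ω)] with x hx
    rw [hx]
    simp
  add_mem' := by
    intro j k hj hk
    change ∀ᵐ x ∂(volume.restrict Ω), ∑ i : Fin d, ((j.2 i + k.2 i : L2 Ω) x) i = 0
    have h : ∀ i : Fin d, ∀ᵐ x ∂(volume.restrict Ω),
        ((j.2 i + k.2 i : L2 Ω) x) = j.2 i x + k.2 i x :=
      fun i => Lp.coeFn_add (j.2 i) (k.2 i)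
    filter_upwards [ae_all_iff.2 h, hj, hk] with x hx hjx hkx
    simp_rw [hx]
    simp [Finset.sum_add_distrib, hjx, hkx]
  smul_mem' := by
    intro c j hj
    change ∀ᵐ x ∂(volume.restrict Ω), ∑ i : Fin d, ((c • j.2 i : L2 Ω) x) i = 0
    have h : ∀ i : Fin d, ∀ᵐ x ∂(volume.restrict Ω),
        ((c • j.2 i : L2 Ω) x) = c • j.2 i x :=
      fun i => Lp.coeFn_smul c (j.2 i)
    filter_upwards [ae_all_iff.2 h, hj] with x hx hjx
    simp [hx, ← Finset.mul_sum, hjx]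

/-- `V = {u ∈ H¹₀(Ω)ᵈ : div u = 0}`, with the `H¹` topology. -/
def V {d : ℕ} (Ω : Set (Rd d)) : Submodule ℝ (Jet Ω) := H10 Ω ⊓ divFree Ω

/-- The vector field underlying an element of `V`. -/
def fld {d : ℕ} {Ω : Set (Rd d)} (u : V Ω) : L2 Ω := (u : Jet Ω).1

/-- The partial derivative `∂ᵢ u ∈ L²(Ω)ᵈ` of an element `u` of `V`. -/
def pd {d : ℕ} {Ω : Set (Rd d)} (u : V Ω) (i : Fin d) : L2 Ω := (u : Jet Ω).2 i

/-- `∫_Ω ∇u : ∇w`. -/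
def gradInner {d : ℕ} {Ω : Set (Rd d)} (u w : V Ω) : ℝ := ∑ i : Fin d, inner ℝ (pd u i) (pd w i)

/-- `H = {f ∈ L²(Ω)ᵈ : div f = 0, f · ν = 0 on ∂Ω}`; the two conditions are expressed weakly,
through Green's formula, by `∫_Ω f · ∇p = 0` for all `p ∈ H¹(Ω)`. -/
def MemH {d : ℕ} (Ω : Set (Rd d)) (f : L2 Ω) : Prop :=
  ∀ (p : L2s Ω) (G : L2 Ω), HasWeakGradient Ω p G → inner ℝ f G = 0

/-- `S i j = ∂ⱼ ∂ᵢ u` for all `i, j`; the existence of such an `S` means `u ∈ H²(Ω)ᵈ`. -/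
def HasHessian {d : ℕ} {Ω : Set (Rd d)} (u : V Ω) (S : Fin d → Fin d → L2 Ω) : Prop :=
  ∀ i j : Fin d, HasWeakPartial Ω j (fun x => pd u i x) (fun x => S i j x)

/-- The domain is regular enough for the Stokes operator to have its usual domain `V ∩ H²`:
a field `u ∈ V` with `∫ ∇u : ∇w = ∫ f · w` for all `w ∈ V`, where `f ∈ L²`, belongs to `H²`, and
`-Δu + ∇p = f` for some pressure `p ∈ H¹`. -/
def StokesRegular {d : ℕ} (Ω : Set (Rd d)) : Prop :=
  ∀ (u : V Ω) (f : L2 Ω), (∀ w : V Ω, gradInner u w = inner ℝ f (fld w)) →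
    ∃ (S : Fin d → Fin d → L2 Ω) (p : L2s Ω) (G : L2 Ω),
      HasHessian u S ∧ HasWeakGradient Ω p G ∧
      ∀ᵐ x ∂(volume.restrict Ω), - (∑ i : Fin d, S i i x) + G x = f x

/-- The velocity `∂ₜ u(t)`, the derivative in `L²(Ω)ᵈ`. -/
def velocity {d : ℕ} {Ω : Set (Rd d)} (u : ℝ → V Ω) (t : ℝ) : L2 Ω :=
  deriv (fun s => fld (u s)) t

/-- The energy `E[u](t) = ½ ∫_Ω (|∂ₜu|² + |∇u|²)`. -/
def energy {d : ℕ} {Ω : Set (Rd d)} (u : ℝ → V Ω) (t : ℝ) : ℝ :=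
  (1 / 2) * ∫ x in Ω, (‖velocity u t x‖ ^ 2 + ∑ i : Fin d, ‖pd (u t) i x‖ ^ 2)

/-- The dissipation `D[u](T) = ∫₀ᵀ ∫_Ω a |∂ₜu|²`. -/
def dissipation {d : ℕ} {Ω : Set (Rd d)} (a : Rd d → ℝ) (u : ℝ → V Ω) (T : ℝ) : ℝ :=
  ∫ t in (0 : ℝ)..T, ∫ x in Ω, a x * ‖velocity u t x‖ ^ 2

/-- `u ∈ C(ℝ; V ∩ H²) ∩ C¹(ℝ; V)` solves `∂ₜ²u - Δu + ∇p + a ∂ₜu = 0`, `div u = 0` in `ℝ × Ω`,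
`u = 0` on `ℝ × ∂Ω`, for some pressure `p` with `p(t) ∈ H¹(Ω)`. The last two equations of the
system are contained in `u(t) ∈ V`. -/
def IsStrongSolution {d : ℕ} {Ω : Set (Rd d)} (a : Rd d → ℝ) (u : ℝ → V Ω) : Prop :=
  ContDiff ℝ 1 u ∧
  ∃ S : ℝ → Fin d → Fin d → L2 Ω, Continuous S ∧ (∀ t, HasHessian (u t) (S t)) ∧
    ∀ t : ℝ, ∃ (acc : L2 Ω) (p : L2s Ω) (G : L2 Ω),
      HasDerivAt (velocity u) acc t ∧ HasWeakGradient Ω p G ∧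
      ∀ᵐ x ∂(volume.restrict Ω),
        acc x - (∑ i : Fin d, S t i i x) + G x + a x • velocity u t x = 0

/-- `u ∈ C(ℝ; V) ∩ C¹(ℝ; H)` is a weak (finite energy) solution of the same system:
`d/dt ∫ ∂ₜu · w + ∫ ∇u : ∇w + ∫ a ∂ₜu · w = 0` for all `w ∈ V`. The pressure is eliminated, as
`w` is divergence-free and vanishes on the boundary; and as the last two integrals are
continuous in time, the equation holds in `𝒟'(ℝ)` if and only if it holds at every time. -/
def IsWeakSolution {d : ℕ} {Ω : Set (Rd d)} (a : Rd d → ℝ) (u : ℝ → V Ω) : Prop :=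
  Continuous u ∧ ContDiff ℝ 1 (fun t => fld (u t)) ∧ (∀ t, MemH Ω (velocity u t)) ∧
  ∀ (w : V Ω) (t : ℝ),
    HasDerivAt (fun s => inner ℝ (velocity u s) (fld w))
      (-(gradInner (u t) w) - ∫ x in Ω, a x * inner ℝ (velocity u t x) (fld w x)) t

/-- Exponential decay of the energy, uniformly over a class of solutions. -/
def Stabilization {d : ℕ} {Ω : Set (Rd d)} (IsSol : (ℝ → V Ω) → Prop) : Prop :=
  ∃ C₀ > (0 : ℝ), ∃ α > (0 : ℝ), ∀ u : ℝ → V Ω, IsSol u →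
    ∀ t : ℝ, 0 ≤ t → energy u t ≤ C₀ * energy u 0 * Real.exp (-α * t)

/-- The observability inequality, at some time `T > 0`, uniformly over a class of solutions. -/
def Observability {d : ℕ} {Ω : Set (Rd d)} (a : Rd d → ℝ) (IsSol : (ℝ → V Ω) → Prop) : Prop :=
  ∃ C > (0 : ℝ), ∃ T > (0 : ℝ), ∀ v : ℝ → V Ω, IsSol v → energy v 0 ≤ C * dissipation a v T

end HypStokes

end

open Filter

noncomputable section

namespace HypStokes

/-! ### Stone's theorem on a real Hilbert space, from the bounded inverse of the generator. -/

section UnitaryGroup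

variable {E : Type*} [NormedAddCommGroup E] [InnerProductSpace ℝ E]

/-! The state `X = (u, ∂ₜu)` lives in the Hilbert space `VE Ω × H0 Ω`: here `V` carries the norm
`‖∇u‖`, `H0` is the closure of `V` in `L²`, and the energy is `½‖X‖²`. The system becomes `X' = A X
- B X`, with `A` unbounded and skew-adjoint, and `B` bounded, symmetric and nonnegative, with `⟨B X,
X⟩ = ∫ a |∂ₜu|²`.

The equivalence is a comparison argument in the manner of Haraux. Let `X` be damped and `Y` undamped
with the same initial state. The energy identity for `X - Y` bounds the dissipation of either
solution on `[0, T]` by that of the other (`IsMild.dissipation_le`, `IsMild.le_dissipation`). Since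
`‖X‖²` decreases over `[0, T]` by exactly twice the dissipation of `X`, observability says that a
fixed fraction of the energy is lost over every period, which iterates to exponential decay.
Conversely, decay forces half of the energy to be lost by some time `T`. This is
`stabilization_iff_observability`. It only needs the two classes to share their data: every state,
at any time, of a damped solution starts an undamped one, and every initial state of an undamped
solution starts a damped one.

Unbounded operators are avoided by working with `G = A⁻¹`, that is `(f, g) ↦ (-J* g, J f)` with `J :
V → H0` the embedding; it is bounded, skew and injective. A mild solution satisfies the equation
after application of `G`. Stone's theorem (`IsSkew.exists_isUnitaryGroup`) yields existence and the
energy identity, and `isMild_waveOp_iff` identifies mild solutions with weak ones.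

For finite energy solutions every state is admissible data. For strong solutions the data form the
domain of `A`, which does not depend on the bounded damping; Stokes regularity turns membership in
it into `H²` regularity, with a Hessian continuous in time by the closed graph theorem. -/

/-- A bounded operator is skew-symmetric. -/
def IsSkew (G : E →L[ℝ] E) : Prop := ∀ x y : E, inner ℝ (G x) y = -inner ℝ x (G y)

theorem IsSkew.inner_self {G : E →L[ℝ] E} (hG : IsSkew G) (x : E) : inner ℝ (G x) x = 0 := by
  have h := hG x x
  rw [real_inner_comm (G x) x] at h
  linarith

/-- The orthogonal complement of the range is the kernel of the adjoint `-G`, which is trivial. -/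
theorem IsSkew.denseRange [CompleteSpace E] {G : E →L[ℝ] E} (hG : IsSkew G)
    (hinj : Function.Injective G) : DenseRange G := by
  have h : (LinearMap.range (G : E →ₗ[ℝ] E)).topologicalClosure = ⊤ := by
    rw [Submodule.topologicalClosure_eq_top_iff, Submodule.eq_bot_iff]
    intro x hx
    apply hinj
    rw [map_zero, ← inner_self_eq_zero (𝕜 := ℝ), hG, neg_eq_zero, real_inner_comm]
    exact hx _ ⟨G x, rfl⟩
  have h2 := Submodule.dense_iff_topologicalClosure_eq_top.2 h
  exact h2

/-- The Yosida regularization `-G (ε² - G²)⁻¹` of the inverse of `G`. -/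
theorem IsSkew.exists_yosida [CompleteSpace E] {G : E →L[ℝ] E} (hG : IsSkew G) {ε : ℝ}
    (hε : 0 < ε) :
    ∃ K : E →L[ℝ] E, IsSkew K ∧ (∀ T : E →L[ℝ] E, Commute T G → Commute T K) ∧
      (∀ y, ‖K (G y)‖ ≤ ‖y‖) ∧ ∀ z, ‖K (G (G z)) - G z‖ ≤ ε * ‖z‖ := by
  -- Skewness makes `-G²` nonnegative, so `ε² - G²` is coercive, hence invertible. Formally `-G (ε²
  -- - G²)⁻¹` tends to `G⁻¹` as `ε → 0`.
  set T : E →L[ℝ] E := (ε ^ 2) • (1 : E →L[ℝ] E) - G * G with hT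
  have hTx : ∀ x, T x = ε ^ 2 • x - G (G x) := fun x => rfl
  have hcoer : ∀ x, inner ℝ (T x) x = ε ^ 2 * ‖x‖ ^ 2 + ‖G x‖ ^ 2 := by
    intro x
    rw [hTx, inner_sub_left, real_inner_smul_left, hG (G x) x, real_inner_self_eq_norm_sq,
      real_inner_self_eq_norm_sq]
    ring
  have hunit : IsUnit T := by
    refine ContinuousLinearMap.isUnit_of_forall_le_norm_inner_map T
      (c := ⟨ε ^ 2, by positivity⟩) (show (0 : ℝ) < ε ^ 2 by positivity) fun x => ?_
    rw [hcoer, Real.norm_of_nonneg (by positivity)]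
    change ‖x‖ ^ 2 * ε ^ 2 ≤ _
    nlinarith [sq_nonneg ‖G x‖]
  obtain ⟨u, hu⟩ := hunit
  set R : E →L[ℝ] E := ↑u⁻¹ with hR
  have hTR : ∀ x, T (R x) = x := by
    intro x
    have : (u : E →L[ℝ] E) * ↑u⁻¹ = 1 := u.mul_inv
    rw [hu] at this
    exact congrArg (fun A : E →L[ℝ] E => A x) this
  have hcomm : ∀ S : E →L[ℝ] E, Commute S G → Commute S R := by
    intro S hS
    apply Commute.units_inv_right
    rw [hu, hT]
    exact ((Commute.one_right S).smul_right _).sub_right (hS.mul_right hS)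
  have hGR : ∀ x, G (R x) = R (G x) := fun x =>
    congrArg (fun A : E →L[ℝ] E => A x) (hcomm G (Commute.refl G)).eq
  have hTs : ∀ x y, inner ℝ (T x) y = inner ℝ x (T y) := by
    intro x y
    rw [hTx, hTx, inner_sub_left, inner_sub_right, real_inner_smul_left, real_inner_smul_right,
      hG, hG x]
    linarith [hG x (G y)]
  have hRs : ∀ x y, inner ℝ (R x) y = inner ℝ x (R y) := by
    intro x y
    conv_lhs => rw [← hTR y]
    rw [← hTs, hTR]
  refine ⟨-(R * G), ?_, ?_, ?_, ?_⟩
  · intro x y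
    change inner ℝ (-(R (G x))) y = -inner ℝ x (-(R (G y)))
    rw [inner_neg_left, inner_neg_right, hRs, hG, hGR]
  · intro S hS
    exact ((hcomm S hS).mul_right hS).neg_right
  · intro y
    change ‖-(R (G (G y)))‖ ≤ ‖y‖
    rw [norm_neg, ← hGR, ← hGR]
    have h1 : y = ε ^ 2 • R y - G (G (R y)) := by rw [← hTx, hTR]
    have h2 : ‖y‖ ^ 2 = ‖ε ^ 2 • R y‖ ^ 2 + 2 * (ε ^ 2 * ‖G (R y)‖ ^ 2) + ‖G (G (R y))‖ ^ 2 := by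
      conv_lhs => rw [h1]
      rw [norm_sub_sq_real, real_inner_smul_left]
      have := hG (R y) (G (R y))
      rw [real_inner_self_eq_norm_sq] at this
      rw [show inner ℝ (R y) (G (G (R y))) = -‖G (R y)‖ ^ 2 by linarith]
      ring
    apply (pow_le_pow_iff_left₀ (by positivity) (norm_nonneg _) two_ne_zero).1
    rw [h2]
    have : 0 ≤ ‖ε ^ 2 • R y‖ ^ 2 := by positivity
    have : 0 ≤ ε ^ 2 * ‖G (R y)‖ ^ 2 := by positivity
    linarith
  · intro z
    change ‖-(R (G (G (G z)))) - G z‖ ≤ ε * ‖z‖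
    have h1 : -(R (G (G (G z)))) - G z = -(ε ^ 2 • R (G z)) := by
      have h := hTR (G z)
      rw [hTx, hGR (G z), hGR (G (G z))] at h
      conv_lhs => rw [← h]
      rw [h]
      have h3 : R (G (G (G z))) = ε ^ 2 • R (G z) - G z := by
        rw [sub_eq_iff_eq_add] at h
        rw [h]; abel
      rw [h3]; abel
    set y := R (G z) with hy
    have h2 : ε ^ 2 * ‖y‖ ^ 2 + ‖G y‖ ^ 2 = -inner ℝ z (G y) := by
      rw [← hcoer, hy, hTR, ← hy, hG]
    have h3 : -inner ℝ z (G y) ≤ ‖z‖ * ‖G y‖ :=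
      (neg_le_abs _).trans (abs_real_inner_le_norm z (G y))
    rw [h1, norm_neg, norm_smul, Real.norm_of_nonneg (by positivity)]
    -- From `h2` and `h3`, `ε²‖y‖² ≤ ‖z‖‖G y‖ - ‖G y‖² ≤ ‖z‖² / 4`.
    have h4 : ε * ‖y‖ ≤ ‖z‖ := by
      apply (pow_le_pow_iff_left₀ (by positivity) (norm_nonneg _) two_ne_zero).1
      nlinarith [sq_nonneg (‖G y‖ - ‖z‖), sq_nonneg (‖G y‖ + ‖z‖), sq_nonneg (‖G y‖),
        sq_nonneg ‖z‖]
    nlinarith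

/-- `U` is the strongly continuous group of isometries generated by the inverse of `G`. -/
structure IsUnitaryGroup (G : E →L[ℝ] E) (U : ℝ → E →L[ℝ] E) : Prop where
  zero : ∀ x, U 0 x = x
  add : ∀ s t x, U (s + t) x = U s (U t x)
  norm_map : ∀ t x, ‖U t x‖ = ‖x‖
  continuous : ∀ x, Continuous fun t => U t x
  comm : ∀ t x, G (U t x) = U t (G x)
  hasDerivAt : ∀ x t, HasDerivAt (fun s => U s (G x)) (U t x) t

/-- The derivative of `‖exp(tK) x‖²` is `2⟨exp(tK) x, K exp(tK) x⟩`, which vanishes for skew `K`. -/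
theorem IsSkew.norm_exp_smul [CompleteSpace E] {K : E →L[ℝ] E} (hK : IsSkew K) (t : ℝ) (x : E) :
    ‖NormedSpace.exp (t • K) x‖ = ‖x‖ := by
  have hd : ∀ s, HasDerivAt (fun s : ℝ => NormedSpace.exp (s • K) x)
      (K (NormedSpace.exp (s • K) x)) s := by
    intro s
    have h := (hasDerivAt_exp_smul_const (𝕂 := ℝ) K s).clm_apply (hasDerivAt_const s x)
    have hc : NormedSpace.exp (s • K) * K = K * NormedSpace.exp (s • K) :=
      (((Commute.refl K).smul_left s).exp_left).eq
    rw [hc] at h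
    simpa using h
  have hsq : ∀ s, HasDerivAt (fun s : ℝ => ‖NormedSpace.exp (s • K) x‖ ^ 2) 0 s := by
    intro s
    have h := (hd s).norm_sq
    rwa [real_inner_comm, hK.inner_self, mul_zero] at h
  have h := is_const_of_deriv_eq_zero (fun s => (hsq s).differentiableAt)
    (fun s => (hsq s).deriv) t 0
  simp only [zero_smul, NormedSpace.exp_zero, one_apply_eq_self] at h
  exact (sq_eq_sq₀ (norm_nonneg _) (norm_nonneg _)).1 h

theorem hasDerivAt_exp_smul_apply [CompleteSpace E] (K : E →L[ℝ] E) (x : E) (s : ℝ) :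
    HasDerivAt (fun s : ℝ => NormedSpace.exp (s • K) x) (NormedSpace.exp (s • K) (K x)) s := by
  simpa using (hasDerivAt_exp_smul_const (𝕂 := ℝ) K s).clm_apply (hasDerivAt_const s x)

/-- By commutation `exp(tK) = exp(tL) exp(t(K - L))`. The first factor is an isometry, and the orbit
of `x` under the second moves at constant speed `‖(K - L) x‖`. -/
theorem norm_exp_smul_sub_exp_smul_le [CompleteSpace E] {K L : E →L[ℝ] E} (hK : IsSkew K)
    (hL : IsSkew L) (hKL : Commute K L) (t : ℝ) (x : E) :
    ‖NormedSpace.exp (t • K) x - NormedSpace.exp (t • L) x‖ ≤ ‖K x - L x‖ * |t| := by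
  have hskew : IsSkew (K - L) := by
    intro x y
    simp only [sub_apply, inner_sub_left, inner_sub_right, hK x, hL x]
    ring
  have hsplit : NormedSpace.exp (t • K) = NormedSpace.exp (t • L) *
      NormedSpace.exp (t • (K - L)) := by
    let _ : NormedAlgebra ℚ (E →L[ℝ] E) := NormedAlgebra.restrictScalars ℚ ℝ _
    rw [← NormedSpace.exp_add_of_commute]
    · congr 1
      rw [← smul_add]; abel_nf
    · exact ((hKL.symm.sub_right (Commute.refl L)).smul_right t).smul_left t
  have h1 : NormedSpace.exp (t • K) x - NormedSpace.exp (t • L) x =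
      NormedSpace.exp (t • L) (NormedSpace.exp (t • (K - L)) x - x) := by
    rw [hsplit, map_sub]; rfl
  rw [h1, hL.norm_exp_smul]
  have h := Convex.norm_image_sub_le_of_norm_hasDerivWithin_le (𝕜 := ℝ) (s := Set.univ)
    (x := 0) (y := t) (C := ‖K x - L x‖)
    (fun s _ => (hasDerivAt_exp_smul_apply (K - L) x s).hasDerivWithinAt)
    (fun s _ => by rw [hskew.norm_exp_smul]; rfl) convex_univ trivial trivial
  simpa using h

theorem tendsto_zero_of_dense {T : ℕ → E →L[ℝ] E} {C : ℝ} (hT : ∀ n x, ‖T n x‖ ≤ C * ‖x‖)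
    {s : Set E} (hs : Dense s) (h : ∀ x ∈ s, Tendsto (fun n => T n x) atTop (𝓝 0)) (x : E) :
    Tendsto (fun n => T n x) atTop (𝓝 0) := by
  rw [Metric.tendsto_atTop]
  intro ε hε
  obtain ⟨y, hys, hy⟩ := hs.exists_dist_lt x (show 0 < ε / (2 * (|C| + 1)) by positivity)
  obtain ⟨N, hN⟩ := Metric.tendsto_atTop.1 (h y hys) (ε / 2) (by positivity)
  refine ⟨N, fun n hn => ?_⟩
  have h1 := hN n hn
  rw [dist_zero_right] at h1 ⊢
  rw [dist_eq_norm] at hy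
  have h2 : T n x = T n (x - y) + T n y := by rw [map_sub]; abel
  have h3 : ‖T n (x - y)‖ ≤ ε / 2 := by
    calc ‖T n (x - y)‖ ≤ C * ‖x - y‖ := hT n _
      _ ≤ (|C| + 1) * ‖x - y‖ := by gcongr; linarith [le_abs_self C]
      _ ≤ (|C| + 1) * (ε / (2 * (|C| + 1))) := by gcongr
      _ = ε / 2 := by field_simp
  rw [h2]
  linarith [norm_add_le (T n (x - y)) (T n y)]

theorem cauchySeq_of_dense {T : ℕ → E →L[ℝ] E} (hT : ∀ n x, ‖T n x‖ = ‖x‖)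
    {s : Set E} (hs : Dense s) (h : ∀ x ∈ s, CauchySeq (fun n => T n x)) (x : E) :
    CauchySeq (fun n => T n x) := by
  rw [Metric.cauchySeq_iff']
  intro ε hε
  obtain ⟨y, hys, hy⟩ := hs.exists_dist_lt x (show 0 < ε / 3 by positivity)
  obtain ⟨N, hN⟩ := Metric.cauchySeq_iff'.1 (h y hys) (ε / 3) (by positivity)
  refine ⟨N, fun n hn => ?_⟩
  have h1 : ∀ n, dist (T n x) (T n y) < ε / 3 := by
    intro n
    rw [dist_eq_norm, ← map_sub, hT, ← dist_eq_norm]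
    exact hy
  have h2 := dist_triangle4 (T n x) (T n y) (T N y) (T N x)
  have h3 := h1 N
  rw [dist_comm] at h3
  linarith [h1 n, hN n hn]

/-- Stone's theorem for the inverse of an injective bounded skew-symmetric operator. -/
theorem IsSkew.exists_isUnitaryGroup [CompleteSpace E] {G : E →L[ℝ] E} (hG : IsSkew G)
    (hinj : Function.Injective G) : ∃ U : ℝ → E →L[ℝ] E, IsUnitaryGroup G U := by
  have hden : DenseRange G := hG.denseRange hinj
  have hden2 : DenseRange (fun z => G (G z)) := hden.comp hden G.continuous
  choose K hKs hKc hKb hKa using fun n : ℕ =>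
    hG.exists_yosida (ε := 1 / ((n : ℝ) + 1)) (by positivity)
  have hK1 : ∀ z, Tendsto (fun n => K n (G (G z))) atTop (𝓝 (G z)) := by
    intro z
    rw [tendsto_iff_norm_sub_tendsto_zero]
    refine squeeze_zero (fun _ => norm_nonneg _) (fun n => hKa n z) ?_
    simpa using tendsto_one_div_add_atTop_nhds_zero_nat.mul_const ‖z‖
  have hK2 : ∀ y, Tendsto (fun n => K n (G y)) atTop (𝓝 y) := by
    intro y
    -- Convergence on the range of `G` is `hK1`; it extends to all `y` because the operators `K n ∘
    -- G - id` are uniformly bounded by 2.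
    have h := tendsto_zero_of_dense (T := fun n => (K n).comp G - ContinuousLinearMap.id ℝ E)
      (C := 2) (s := Set.range G) ?_ hden ?_ y
    · simpa using h.add_const y
    · intro n x
      change ‖K n (G x) - x‖ ≤ _
      linarith [hKb n x, norm_sub_le (K n (G x)) x]
    · rintro _ ⟨z, rfl⟩
      simpa using (hK1 z).sub_const (G z)
  set W : ℕ → ℝ → E →L[ℝ] E := fun n t => NormedSpace.exp (t • K n) with hW
  have hWn : ∀ n t x, ‖W n t x‖ = ‖x‖ := fun n t x => (hKs n).norm_exp_smul t x
  have hWG : ∀ n t x, G (W n t x) = W n t (G x) := by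
    intro n t x
    have : Commute G (W n t) := ((hKc n G (Commute.refl G)).smul_right t).exp_right
    exact congrArg (fun A : E →L[ℝ] E => A x) this.eq
  -- On the dense range of `G²` the vectors `K n x` converge, so the distance between the `m`-th and
  -- `n`-th orbits, at most `‖K m x - K n x‖ |t|`, is small.
  have hWc : ∀ t x, CauchySeq (fun n => W n t x) := by
    intro t
    refine cauchySeq_of_dense (fun n => hWn n t) hden2 ?_
    rintro _ ⟨z, rfl⟩
    have hc := (hK1 z).cauchySeq
    rw [Metric.cauchySeq_iff] at hc ⊢
    intro ε hε
    obtain ⟨N, hN⟩ := hc (ε / (|t| + 1)) (by positivity)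
    refine ⟨N, fun m hm n hn => ?_⟩
    rw [dist_eq_norm]
    refine (norm_exp_smul_sub_exp_smul_le (hKs m) (hKs n)
      (hKc n (K m) (hKc m G (Commute.refl G)).symm) t _).trans_lt ?_
    have h := hN m hm n hn
    rw [dist_eq_norm, lt_div_iff₀ (by positivity)] at h
    refine lt_of_le_of_lt ?_ h
    gcongr
    linarith
  choose f hf using fun t x => cauchySeq_tendsto_of_complete (hWc t x)
  set U : ℝ → E →L[ℝ] E := fun t =>
    continuousLinearMapOfTendsto (fun n => W n t) (f := f t) (tendsto_pi_nhds.2 (hf t)) with hU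
  have hWU : ∀ t x, Tendsto (fun n => W n t x) atTop (𝓝 (U t x)) := hf
  have hUn : ∀ t x, ‖U t x‖ = ‖x‖ := fun t x =>
    tendsto_nhds_unique (hWU t x).norm (by simp [hWn])
  have hUG : ∀ t x, G (U t x) = U t (G x) := by
    intro t x
    refine tendsto_nhds_unique ((G.continuous.tendsto _).comp (hWU t x)) ?_
    simpa [Function.comp_def, hWG] using hWU t (G x)
  have hWd : ∀ n x s, HasDerivAt (fun s => W n s x) (W n s (K n x)) s :=
    fun n x s => hasDerivAt_exp_smul_apply (K n) x s
  have hWcont : ∀ n x, Continuous fun s => W n s x := fun n x =>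
    continuous_iff_continuousAt.2 fun s => (hWd n x s).continuousAt
  -- The approximate orbits of `G y` have speed `‖K n (G y)‖ ≤ ‖y‖`, so the Lipschitz bound passes
  -- to the limit.
  have hUcG : ∀ y, Continuous fun t => U t (G y) := by
    intro y
    refine LipschitzWith.continuous (K := ‖y‖₊) (LipschitzWith.of_dist_le_mul fun t s => ?_)
    rw [dist_eq_norm, dist_eq_norm]
    refine le_of_tendsto ((hWU t (G y)).sub (hWU s (G y))).norm (Eventually.of_forall fun n => ?_)
    exact Convex.norm_image_sub_le_of_norm_hasDerivWithin_le (𝕜 := ℝ) (s := Set.univ)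
      (fun s _ => (hWd n (G y) s).hasDerivWithinAt)
      (fun s _ => by rw [hWn]; exact hKb n y) convex_univ trivial trivial
  have hUc : ∀ x, Continuous fun t => U t x := by
    intro x
    rw [Metric.continuous_iff]
    intro t ε hε
    obtain ⟨y, hy⟩ := hden.exists_dist_lt x (show 0 < ε / 3 by positivity)
    obtain ⟨δ, hδ, h⟩ := Metric.continuous_iff.1 (hUcG y) t (ε / 3) (by positivity)
    refine ⟨δ, hδ, fun s hs => ?_⟩
    have h1 : ∀ r, dist (U r x) (U r (G y)) < ε / 3 := by
      intro r
      rw [dist_eq_norm, ← map_sub, hUn, ← dist_eq_norm]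
      exact hy
    have h2 := dist_triangle4 (U s x) (U s (G y)) (U t (G y)) (U t x)
    have h3 := h1 t
    rw [dist_comm] at h3
    linarith [h1 s, h s hs]
  -- The generator appears only in integrated form: the limit of the fundamental theorem of calculus
  -- for the approximate orbits, by dominated convergence.
  have hint : ∀ y t, U t (G y) = G y + ∫ s in (0 : ℝ)..t, U s y := by
    intro y t
    have h1 : ∀ n, ∫ s in (0 : ℝ)..t, W n s (K n (G y)) = W n t (G y) - G y := by
      intro n
      rw [intervalIntegral.integral_eq_sub_of_hasDerivAt (fun s _ => hWd n (G y) s)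
        ((hWcont n _).intervalIntegrable _ _)]
      simp [hW]
    have h2 : Tendsto (fun n => ∫ s in (0 : ℝ)..t, W n s (K n (G y))) atTop
        (𝓝 (∫ s in (0 : ℝ)..t, U s y)) := by
      refine intervalIntegral.tendsto_integral_filter_of_dominated_convergence (fun _ => ‖y‖)
        (Eventually.of_forall fun n => (hWcont n _).aestronglyMeasurable)
        (Eventually.of_forall fun n => Eventually.of_forall fun s _ => ?_)
        intervalIntegrable_const (Eventually.of_forall fun s _ => ?_)
      · rw [hWn]; exact hKb n y
      · have h3 : Tendsto (fun n => W n s (K n (G y) - y)) atTop (𝓝 0) := by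
          rw [tendsto_zero_iff_norm_tendsto_zero]
          simp only [hWn]
          simpa using ((hK2 y).sub_const y).norm
        simpa using h3.add (hWU s y)
    simp only [h1] at h2
    rw [tendsto_nhds_unique h2 ((hWU t (G y)).sub_const (G y))]
    abel
  refine ⟨U, fun x => ?_, fun s t x => ?_, hUn, hUc, hUG, fun x t => ?_⟩
  · refine tendsto_nhds_unique (hWU 0 x) ?_
    simp [hW]
  · have h1 : ∀ n, W n (s + t) x = W n s (W n t x) := by
      intro n
      have : W n (s + t) = W n s * W n t := by
        let _ : NormedAlgebra ℚ (E →L[ℝ] E) := NormedAlgebra.restrictScalars ℚ ℝ _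
        simp only [hW]
        rw [add_smul, NormedSpace.exp_add_of_commute]
        exact ((Commute.refl (K n)).smul_right t).smul_left s
      rw [this]; rfl
    refine tendsto_nhds_unique (hWU (s + t) x) ?_
    have h3 : Tendsto (fun n => W n s (W n t x - U t x)) atTop (𝓝 0) := by
      rw [tendsto_zero_iff_norm_tendsto_zero]
      simp only [hWn]
      simpa using ((hWU t x).sub_const (U t x)).norm
    simpa [h1] using h3.add (hWU s (U t x))
  · have h := ((hUc x).integral_hasStrictDerivAt 0 t).hasDerivAt.const_add (G x)
    exact h.congr_of_eventuallyEq (Eventually.of_forall fun s => hint x s)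

end UnitaryGroup

/-! ### Mild solutions: energy identity and existence. -/

section Mild

variable {E : Type*} [NormedAddCommGroup E] [InnerProductSpace ℝ E]

/-- Strong continuity suffices, since the uniform bound absorbs the variation of `Z`; norm
continuity of `C` is not available for the groups below. -/
theorem continuous_apply_of_norm_le {C : ℝ → E →L[ℝ] E} {L : ℝ}
    (hC : ∀ x, Continuous fun t => C t x) (hL : ∀ t x, ‖C t x‖ ≤ L * ‖x‖) {Z : ℝ → E}
    (hZ : Continuous Z) : Continuous fun t => C t (Z t) := by
  rw [continuous_iff_continuousAt]
  intro t
  have h1 : Tendsto (fun s => C s (Z s - Z t)) (𝓝 t) (𝓝 0) := by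
    refine squeeze_zero_norm (fun s => hL s _) ?_
    have : Continuous fun s => L * ‖Z s - Z t‖ := by fun_prop
    simpa using this.tendsto t
  have h2 := h1.add ((hC (Z t)).tendsto t)
  simpa [ContinuousAt] using h2

theorem IsUnitaryGroup.continuous_apply {G : E →L[ℝ] E} {U : ℝ → E →L[ℝ] E}
    (hU : IsUnitaryGroup G U) {Z : ℝ → E} (hZ : Continuous Z) :
    Continuous fun t => U t (Z t) :=
  continuous_apply_of_norm_le hU.continuous (L := 1) (fun t x => by rw [hU.norm_map, one_mul]) hZ

theorem IsUnitaryGroup.neg {G : E →L[ℝ] E} {U : ℝ → E →L[ℝ] E} (hU : IsUnitaryGroup G U) :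
    IsUnitaryGroup (-G) (fun t => U (-t)) where
  zero x := by simpa using hU.zero x
  add s t x := by simp only [neg_add]; exact hU.add _ _ x
  norm_map t := hU.norm_map (-t)
  continuous x := (hU.continuous x).comp continuous_neg
  comm t x := by simp [hU.comm]
  hasDerivAt x t := by
    have h := ((hU.hasDerivAt x (-t)).scomp t (hasDerivAt_neg t)).neg
    refine (h.congr_deriv (by simp)).congr_of_eventuallyEq (Eventually.of_forall fun s => ?_)
    simp

/-- Product rule for a strongly continuous group of isometries. -/
theorem IsUnitaryGroup.hasDerivAt_apply {G : E →L[ℝ] E} {U : ℝ → E →L[ℝ] E}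
    (hU : IsUnitaryGroup G U) {W : ℝ → E} {W' y : E} {t : ℝ} (hW : HasDerivAt W W' t)
    (hy : W t = G y) : HasDerivAt (fun s => U s (W s)) (U t (y + W')) t := by
  -- Expand `W s = W t + (s - t) W' + o(s - t)` and differentiate the three terms separately;
  -- isometries preserve the remainder `o(s - t)`.
  have h1 : HasDerivAt (fun s => U s (W s - W t - (s - t) • W')) 0 t := by
    rw [hasDerivAt_iff_isLittleO]
    refine (Asymptotics.isLittleO_norm_left.1 ?_)
    have := Asymptotics.isLittleO_norm_left.2 (hasDerivAt_iff_isLittleO.1 hW)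
    refine this.congr (fun s => ?_) (fun _ => rfl)
    simp [-map_sub, hU.norm_map]
  have h2 : HasDerivAt (fun s => (s - t) • U s W') (U t W') t := by
    rw [hasDerivAt_iff_isLittleO]
    have h3 : (fun s => U s W' - U t W') =o[𝓝 t] (fun _ => (1 : ℝ)) := by
      rw [Asymptotics.isLittleO_one_iff]
      simpa using ((hU.continuous W').tendsto t).sub_const (U t W')
    have h4 := (Asymptotics.isBigO_refl (fun s : ℝ => s - t) (𝓝 t)).smul_isLittleO h3
    refine h4.congr (fun s => ?_) (fun s => ?_)
    · simp [smul_sub]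
    · simp
  have h3 := (h1.add (hU.hasDerivAt y t)).add h2
  rw [zero_add, ← map_add] at h3
  refine h3.congr_of_eventuallyEq (Eventually.of_forall fun s => ?_)
  rw [← hy]
  simp only [Pi.add_apply, map_sub, map_smul]
  abel

/-- `X` is a mild solution of `X' = G⁻¹ X + Φ`. -/
structure IsMild (G : E →L[ℝ] E) (Φ X : ℝ → E) : Prop where
  continuous : Continuous X
  hasDerivAt : ∀ t, HasDerivAt (fun s => G (X s)) (X t + G (Φ t)) t

theorem IsMild.sub {G : E →L[ℝ] E} {Φ X Ψ Y : ℝ → E} (hX : IsMild G Φ X) (hY : IsMild G Ψ Y) :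
    IsMild G (fun t => Φ t - Ψ t) (fun t => X t - Y t) where
  continuous := hX.continuous.sub hY.continuous
  hasDerivAt t := by
    have h := (hX.hasDerivAt t).sub (hY.hasDerivAt t)
    convert h using 1
    · ext s; simp
    · simp only [map_sub]; abel

theorem IsMild.comp_add {G : E →L[ℝ] E} {Φ X : ℝ → E} (hX : IsMild G Φ X) (τ : ℝ) :
    IsMild G (fun t => Φ (t + τ)) (fun t => X (t + τ)) where
  continuous := hX.continuous.comp (continuous_add_const τ)
  hasDerivAt t := (hX.hasDerivAt (t + τ)).comp_add_const t τ

/-- Integrating an exponential bound of rate `l` gains the factor `1 / l`, which makes the fixed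
point map of `exists_linear_ode` a contraction. -/
theorem norm_integral_le_of_norm_le_exp {f : ℝ → E} {M l : ℝ} (hl : 0 < l)
    (hM : 0 ≤ M) (h : ∀ s, ‖f s‖ ≤ M * Real.exp (l * |s|)) (t : ℝ) :
    ‖∫ s in (0 : ℝ)..t, f s‖ ≤ M / l * Real.exp (l * |t|) := by
  have key : ∀ {g : ℝ → E}, (∀ s, ‖g s‖ ≤ M * Real.exp (l * |s|)) →
      ∀ t, 0 ≤ t → ‖∫ s in (0 : ℝ)..t, g s‖ ≤ M / l * Real.exp (l * |t|) := by
    intro g hg t ht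
    have hd : ∀ s, HasDerivAt (fun s => M / l * Real.exp (l * s)) (M * Real.exp (l * s)) s := by
      intro s
      have h := (((hasDerivAt_id s).const_mul l).exp).const_mul (M / l)
      exact h.congr_deriv (by simp only [id]; field_simp)
    have h1 := intervalIntegral.norm_integral_le_of_norm_le (f := g)
      (g := fun s => M * Real.exp (l * s)) (μ := volume) ht
      (Eventually.of_forall fun s hs => by simpa [abs_of_pos hs.1] using hg s)
      ((by fun_prop : Continuous fun s => M * Real.exp (l * s)).intervalIntegrable _ _)
    refine h1.trans ?_
    rw [intervalIntegral.integral_eq_sub_of_hasDerivAt (fun s _ => hd s)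
      ((by fun_prop : Continuous fun s => M * Real.exp (l * s)).intervalIntegrable _ _),
      abs_of_nonneg ht]
    have : 0 ≤ M / l * Real.exp (l * 0) := by positivity
    linarith
  rcases le_total 0 t with ht | ht
  · exact key h t ht
  · have h1 := key (g := fun s => f (-s)) (fun s => by simpa using h (-s)) (-t) (by linarith)
    rw [intervalIntegral.integral_comp_neg, neg_neg, neg_zero, intervalIntegral.integral_symm,
      norm_neg, abs_neg] at h1
    exact h1

variable [CompleteSpace E]

/-- The energy identity for mild solutions. -/
theorem IsMild.hasDerivAt_norm_sq {G : E →L[ℝ] E} {Φ X : ℝ → E} (hX : IsMild G Φ X)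
    (hG : IsSkew G) (hinj : Function.Injective G) (hΦ : Continuous Φ) (t : ℝ) :
    HasDerivAt (fun s => ‖X s‖ ^ 2) (2 * inner ℝ (X t) (Φ t)) t := by
  obtain ⟨U, hU⟩ := hG.exists_isUnitaryGroup hinj
  have hcX : Continuous fun s => U (-s) (X s) := hU.neg.continuous_apply hX.continuous
  have hcΦ : Continuous fun s => U (-s) (Φ s) := hU.neg.continuous_apply hΦ
  -- `X` need not be differentiable, but in the moving frame `U (-t) X` the generator cancels,
  -- leaving a differentiable curve with derivative `U (-t) Φ`. This is seen first after applying
  -- `G`, then without it by injectivity. Isometry finally removes `U (-t)` from the norm and the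
  -- inner product.
  have h1 : ∀ s, HasDerivAt (fun r => G (U (-r) (X r))) (G (U (-s) (Φ s))) s := by
    intro s
    have h := hU.neg.hasDerivAt_apply (hX.hasDerivAt s) (y := -X s) (by simp)
    simp only [neg_add_cancel_left] at h
    simpa only [hU.comm] using h
  have h2 : ∀ s, U (-s) (X s) = X 0 + ∫ r in (0 : ℝ)..s, U (-r) (Φ r) := by
    intro s
    apply hinj
    rw [map_add, ← ContinuousLinearMap.intervalIntegral_comp_comm _
      (hcΦ.intervalIntegrable _ _), intervalIntegral.integral_eq_sub_of_hasDerivAt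
      (fun r _ => h1 r) ((G.continuous.comp hcΦ).intervalIntegrable _ _)]
    simp [hU.zero]
  have h3 : HasDerivAt (fun s => U (-s) (X s)) (U (-t) (Φ t)) t := by
    have h := (hcΦ.integral_hasStrictDerivAt 0 t).hasDerivAt.const_add (X 0)
    exact h.congr_of_eventuallyEq (Eventually.of_forall h2)
  have h4 := h3.norm_sq
  have h5 : inner ℝ (U (-t) (X t)) (U (-t) (Φ t)) = inner ℝ (X t) (Φ t) :=
    (LinearIsometry.mk (U (-t) : E →ₗ[ℝ] E) (hU.norm_map (-t))).inner_map_map _ _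
  simpa only [hU.norm_map, h5] using h4

/-- Global solvability of linear differential equations with strongly continuous bounded
coefficients. -/
theorem exists_linear_ode {C : ℝ → E →L[ℝ] E} {L : ℝ} (hC : ∀ x, Continuous fun t => C t x)
    (hL : ∀ t x, ‖C t x‖ ≤ L * ‖x‖) (hL0 : 0 ≤ L) (x₀ : E) :
    ∃ Z : ℝ → E, Z 0 = x₀ ∧ ∀ t, HasDerivAt Z (C t (Z t)) t := by
  -- In the weighted norm `sup e^{-l|t|}‖Z t‖` the Picard map has Lipschitz constant `L / l ≤ 1 / 2`
  -- on the whole line; the `+ 1` keeps `l` positive when `L = 0`.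
  set l : ℝ := 2 * (L + 1) with hl
  have hlp : 0 < l := by positivity
  have hcont : ∀ Y : BoundedContinuousFunction ℝ E,
      Continuous fun s => Real.exp (l * |s|) • C s (Y s) := fun Y =>
    (by fun_prop : Continuous fun s : ℝ => Real.exp (l * |s|)).smul
      (continuous_apply_of_norm_le hC hL Y.continuous)
  have hint : ∀ (Y : BoundedContinuousFunction ℝ E) (N : ℝ), (∀ s, ‖Y s‖ ≤ N) → ∀ t,
      ‖∫ s in (0 : ℝ)..t, Real.exp (l * |s|) • C s (Y s)‖ ≤ N / 2 * Real.exp (l * |t|) := by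
    intro Y N hN t
    have hN0 : 0 ≤ N := (norm_nonneg _).trans (hN 0)
    refine (norm_integral_le_of_norm_le_exp hlp (M := L * N) (by positivity)
      (fun s => ?_) t).trans ?_
    · rw [norm_smul, Real.norm_of_nonneg (Real.exp_pos _).le, mul_comm]
      gcongr
      exact (hL s _).trans (by gcongr; exact hN s)
    · gcongr ?_ * _
      rw [div_le_div_iff₀ hlp two_pos, hl]
      nlinarith
  have hexp : ∀ t : ℝ, Real.exp (-(l * |t|)) * Real.exp (l * |t|) = 1 := fun t => by
    rw [← Real.exp_add]; simp
  let 𝒯 : BoundedContinuousFunction ℝ E → BoundedContinuousFunction ℝ E := fun Y =>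
    BoundedContinuousFunction.ofNormedAddCommGroup
      (fun t => Real.exp (-(l * |t|)) •
        (x₀ + ∫ s in (0 : ℝ)..t, Real.exp (l * |s|) • C s (Y s)))
      ((by fun_prop : Continuous fun s : ℝ => Real.exp (-(l * |s|))).smul
        (continuous_const.add (intervalIntegral.continuous_primitive
          (fun a b => (hcont Y).intervalIntegrable a b) 0)))
      (‖x₀‖ + ‖Y‖ / 2) (fun t => by
        rw [norm_smul, Real.norm_of_nonneg (Real.exp_pos _).le]
        have h1 := hint Y ‖Y‖ Y.norm_coe_le_norm t
        have h2 : Real.exp (-(l * |t|)) ≤ 1 := Real.exp_le_one_iff.2 (by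
          have : 0 ≤ l * |t| := by positivity
          linarith)
        calc _ ≤ Real.exp (-(l * |t|)) * (‖x₀‖ + ‖Y‖ / 2 * Real.exp (l * |t|)) := by
              gcongr
              exact (norm_add_le _ _).trans (by gcongr)
          _ = Real.exp (-(l * |t|)) * ‖x₀‖ + ‖Y‖ / 2 := by
              rw [mul_add, mul_left_comm, hexp, mul_one]
          _ ≤ _ := by
              gcongr
              exact mul_le_of_le_one_left (norm_nonneg _) h2)
  have h𝒯 : ∀ Y t, 𝒯 Y t = Real.exp (-(l * |t|)) •
      (x₀ + ∫ s in (0 : ℝ)..t, Real.exp (l * |s|) • C s (Y s)) := fun Y t => rfl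
  have hcontr : ContractingWith (1 / 2) 𝒯 := by
    refine ⟨NNReal.half_lt_self one_ne_zero, LipschitzWith.of_dist_le_mul fun Y Y' => ?_⟩
    rw [dist_eq_norm, dist_eq_norm]
    refine (BoundedContinuousFunction.norm_le (by positivity)).2 fun t => ?_
    rw [BoundedContinuousFunction.sub_apply, h𝒯, h𝒯, ← smul_sub, add_sub_add_left_eq_sub,
      ← intervalIntegral.integral_sub ((hcont Y).intervalIntegrable _ _)
        ((hcont Y').intervalIntegrable _ _)]
    have h1 := hint (Y - Y') ‖Y - Y'‖ (Y - Y').norm_coe_le_norm t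
    simp only [BoundedContinuousFunction.sub_apply, map_sub, smul_sub] at h1
    rw [norm_smul, Real.norm_of_nonneg (Real.exp_pos _).le]
    calc _ ≤ Real.exp (-(l * |t|)) * (‖Y - Y'‖ / 2 * Real.exp (l * |t|)) := by gcongr
      _ = ‖Y - Y'‖ / 2 := by rw [mul_left_comm, hexp, mul_one]
      _ = _ := by simp; ring
  set Y := hcontr.fixedPoint with hY
  have hfix : 𝒯 Y = Y := hcontr.fixedPoint_isFixedPt
  set Z : ℝ → E := fun t => Real.exp (l * |t|) • Y t with hZ
  have hZi : ∀ t, Z t = x₀ + ∫ s in (0 : ℝ)..t, C s (Z s) := by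
    intro t
    have h1 : Z t = Real.exp (l * |t|) • 𝒯 Y t := by rw [hfix]
    rw [h1, h𝒯, smul_smul, mul_comm, hexp, one_smul]
    simp [hZ]
  refine ⟨Z, by simp [hZi 0], fun t => ?_⟩
  have hZc : Continuous fun s => C s (Z s) := by
    simpa [hZ] using hcont Y
  have h := (hZc.integral_hasStrictDerivAt 0 t).hasDerivAt.const_add x₀
  exact h.congr_of_eventuallyEq (Eventually.of_forall hZi)

/-- Existence of mild solutions of the damped equation `X' = G⁻¹ X - B X`. -/
theorem exists_isMild {G : E →L[ℝ] E} (hG : IsSkew G) (hinj : Function.Injective G)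
    (B : E →L[ℝ] E) (x₀ : E) : ∃ X : ℝ → E, X 0 = x₀ ∧ IsMild G (fun t => -B (X t)) X := by
  obtain ⟨U, hU⟩ := hG.exists_isUnitaryGroup hinj
  -- Variation of constants: with `X = U Z` the equation becomes `Z' = -U(-t) B U(t) Z`, whose
  -- coefficients are bounded.
  obtain ⟨Z, hZ0, hZ⟩ := exists_linear_ode
    (C := fun t => -((U (-t)).comp (B.comp (U t)))) (L := ‖B‖)
    (fun x => (hU.neg.continuous_apply (B.continuous.comp (hU.continuous x))).neg)
    (fun t x => by
      change ‖-(U (-t) (B (U t x)))‖ ≤ _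
      rw [norm_neg, hU.norm_map]
      simpa [hU.norm_map] using B.le_opNorm (U t x))
    (norm_nonneg B) x₀
  have hZc : Continuous Z := continuous_iff_continuousAt.2 fun t => (hZ t).continuousAt
  refine ⟨fun t => U t (Z t), by simp [hU.zero, hZ0], hU.continuous_apply hZc, fun t => ?_⟩
  have h1 : HasDerivAt (fun s => G (Z s)) (G (-(U (-t) (B (U t (Z t)))))) t :=
    G.hasFDerivAt.comp_hasDerivAt t (hZ t)
  have h2 := hU.hasDerivAt_apply h1 rfl
  have h3 : U t (Z t + G (-(U (-t) (B (U t (Z t)))))) = U t (Z t) + G (-B (U t (Z t))) := by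
    rw [map_add, ← hU.comm, map_neg, ← hU.add, add_neg_cancel, hU.zero]
  rw [h3] at h2
  simpa only [hU.comm] using h2

end Mild

/-! ### The abstract equivalence of decay and observability. -/

section Equivalence

theorem le_of_hasDerivAt_nonpos {f f' : ℝ → ℝ} (hf : ∀ t, HasDerivAt f (f' t) t)
    (h : ∀ t, 0 ≤ t → f' t ≤ 0) {s t : ℝ} (hs : 0 ≤ s) (hst : s ≤ t) : f t ≤ f s := by
  refine antitoneOn_of_deriv_nonpos (convex_Ici 0)
    (fun x _ => (hf x).continuousAt.continuousWithinAt)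
    (fun x _ => (hf x).differentiableAt.differentiableWithinAt) (fun x hx => ?_)
    (Set.mem_Ici.2 hs) (Set.mem_Ici.2 (hs.trans hst)) hst
  rw [interior_Ici] at hx
  rw [(hf x).deriv]
  exact h x (le_of_lt hx)

/-- A nonincreasing function that contracts over each period decays exponentially. -/
theorem exists_exp_decay {γ T : ℝ} (hγ0 : 0 < γ) (hγ1 : γ < 1) (hT : 0 < T) :
    ∃ C₀ > (0 : ℝ), ∃ α > (0 : ℝ), ∀ f : ℝ → ℝ, 0 ≤ f 0 →
      (∀ s t, 0 ≤ s → s ≤ t → f t ≤ f s) → (∀ t, 0 ≤ t → f (t + T) ≤ γ * f t) →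
      ∀ t, 0 ≤ t → f t ≤ C₀ * f 0 * Real.exp (-α * t) := by
  -- The rate is fixed by `exp(-α T) = γ`; the factor `γ⁻¹` pays for replacing `⌊t / T⌋` by `t / T`.
  refine ⟨γ⁻¹, by positivity, -Real.log γ / T, div_pos (neg_pos.2 (Real.log_neg hγ0 hγ1)) hT,
    fun f hf0 hf hfT t ht => ?_⟩
  have hn : ∀ n : ℕ, f (n * T) ≤ γ ^ n * f 0 := by
    intro n
    induction n with
    | zero => simp
    | succ n ih =>
      have h := hfT (n * T) (by positivity)
      have e : ((n + 1 : ℕ) : ℝ) * T = n * T + T := by push_cast; ring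
      rw [e, pow_succ']
      nlinarith
  have h1 := hf (⌊t / T⌋₊ * T) t (by positivity)
    ((le_div_iff₀ hT).1 (Nat.floor_le (by positivity)))
  refine h1.trans ((hn _).trans ?_)
  have h2 : γ ^ ⌊t / T⌋₊ ≤ γ⁻¹ * Real.exp (-(-Real.log γ / T) * t) := by
    rw [← Real.rpow_natCast, Real.rpow_def_of_pos hγ0, ← Real.exp_log (inv_pos.2 hγ0),
      ← Real.exp_add, Real.exp_le_exp, Real.log_inv]
    have h3 := (Nat.lt_floor_add_one (t / T)).le
    have h4 := Real.log_neg hγ0 hγ1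
    have h5 : -(-Real.log γ / T) * t = Real.log γ * (t / T) := by field_simp
    rw [h5]
    nlinarith
  calc γ ^ ⌊t / T⌋₊ * f 0 ≤ γ⁻¹ * Real.exp (-(-Real.log γ / T) * t) * f 0 := by gcongr
    _ = _ := by ring

variable {E : Type*} [NormedAddCommGroup E] [InnerProductSpace ℝ E]

/-- Parallelogram identity for the form `⟨B x, y⟩`, with the term at `x - y` dropped. -/
theorem inner_add_self_le {B : E →L[ℝ] E} (hBs : ∀ x y, inner ℝ (B x) y = inner ℝ x (B y))
    (hB0 : ∀ x, 0 ≤ inner ℝ (B x) x) (x y : E) :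
    inner ℝ (B (x + y)) (x + y) ≤ 2 * inner ℝ (B x) x + 2 * inner ℝ (B y) y := by
  have h := hB0 (x - y)
  have h2 : inner ℝ (B y) x = inner ℝ (B x) y := by rw [hBs, real_inner_comm]
  simp only [map_sub, map_add, inner_sub_left, inner_sub_right, inner_add_left,
    inner_add_right] at h ⊢
  linarith

/-- Expansion of `0 ≤ ⟨B(x + y), x + y⟩`. -/
theorem neg_two_mul_inner_le {B : E →L[ℝ] E} (hBs : ∀ x y, inner ℝ (B x) y = inner ℝ x (B y))
    (hB0 : ∀ x, 0 ≤ inner ℝ (B x) x) (x y : E) :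
    -(2 * inner ℝ (B x) y) ≤ inner ℝ (B x) x + inner ℝ (B y) y := by
  have h := hB0 (x + y)
  have h2 : inner ℝ (B y) x = inner ℝ (B x) y := by rw [hBs, real_inner_comm]
  simp only [map_add, inner_add_left, inner_add_right] at h
  linarith

theorem inner_apply_self_le (B : E →L[ℝ] E) (x : E) : inner ℝ (B x) x ≤ ‖B‖ * ‖x‖ ^ 2 := by
  calc inner ℝ (B x) x ≤ ‖B x‖ * ‖x‖ := real_inner_le_norm _ _
    _ ≤ ‖B‖ * ‖x‖ * ‖x‖ := by gcongr; exact B.le_opNorm x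
    _ = _ := by ring

theorem continuous_inner_apply (B : E →L[ℝ] E) {X : ℝ → E} (hX : Continuous X) :
    Continuous fun t => inner ℝ (B (X t)) (X t) :=
  (B.continuous.comp hX).inner hX

theorem hasDerivAt_dissipation (B : E →L[ℝ] E) {X : ℝ → E} (hX : Continuous X) (t : ℝ) :
    HasDerivAt (fun t => ∫ s in (0 : ℝ)..t, inner ℝ (B (X s)) (X s)) (inner ℝ (B (X t)) (X t)) t :=
  ((continuous_inner_apply B hX).integral_hasStrictDerivAt 0 t).hasDerivAt

variable [CompleteSpace E] {G B : E →L[ℝ] E}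

theorem IsMild.hasDerivAt_norm_sq_damped (hG : IsSkew G) (hinj : Function.Injective G)
    {X : ℝ → E} (hX : IsMild G (fun t => -B (X t)) X) (t : ℝ) :
    HasDerivAt (fun s => ‖X s‖ ^ 2) (-(2 * inner ℝ (B (X t)) (X t))) t := by
  refine (hX.hasDerivAt_norm_sq hG hinj (B.continuous.comp hX.continuous).neg t).congr_deriv ?_
  rw [inner_neg_right, real_inner_comm]; ring

theorem IsMild.norm_sq_eq_damped (hG : IsSkew G) (hinj : Function.Injective G)
    {X : ℝ → E} (hX : IsMild G (fun t => -B (X t)) X) (T : ℝ) :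
    ‖X T‖ ^ 2 = ‖X 0‖ ^ 2 - 2 * ∫ t in (0 : ℝ)..T, inner ℝ (B (X t)) (X t) := by
  have h := intervalIntegral.integral_eq_sub_of_hasDerivAt (a := 0) (b := T)
    (fun t _ => hX.hasDerivAt_norm_sq_damped hG hinj t)
    (((continuous_inner_apply B hX.continuous).const_mul 2).neg.intervalIntegrable _ _)
  rw [intervalIntegral.integral_neg, intervalIntegral.integral_const_mul] at h
  linarith

theorem IsMild.hasDerivAt_norm_sq_sub (hG : IsSkew G) (hinj : Function.Injective G)
    {X Y : ℝ → E} (hX : IsMild G (fun t => -B (X t)) X) (hY : IsMild G (fun _ => 0) Y) (t : ℝ) :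
    HasDerivAt (fun s => ‖X s - Y s‖ ^ 2) (-(2 * inner ℝ (B (X t)) (X t - Y t))) t := by
  have h := (hX.sub hY).hasDerivAt_norm_sq hG hinj
    ((B.continuous.comp hX.continuous).neg.sub continuous_const) t
  refine h.congr_deriv ?_
  simp only [sub_zero, inner_neg_right]
  rw [real_inner_comm]; ring

/-- Put `W = X - Y`. The derivative of `‖W‖²` is `-2⟨B W, W⟩ - 2⟨B Y, W⟩ ≤ -⟨B W, W⟩ + ⟨B Y, Y⟩`,
while `½⟨B X, X⟩ ≤ ⟨B W, W⟩ + ⟨B Y, Y⟩`. Adding, the terms in `W` cancel and `2⟨B Y, Y⟩` remains, so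
the constant does not depend on `T`. -/
theorem IsMild.dissipation_le (hG : IsSkew G) (hinj : Function.Injective G)
    (hBs : ∀ x y, inner ℝ (B x) y = inner ℝ x (B y)) (hB0 : ∀ x, 0 ≤ inner ℝ (B x) x)
    {X Y : ℝ → E} (hX : IsMild G (fun t => -B (X t)) X) (hY : IsMild G (fun _ => 0) Y)
    (hXY : X 0 = Y 0) {T : ℝ} (hT : 0 ≤ T) :
    ∫ t in (0 : ℝ)..T, inner ℝ (B (X t)) (X t) ≤
      4 * ∫ t in (0 : ℝ)..T, inner ℝ (B (Y t)) (Y t) := by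
  have hd : ∀ t, HasDerivAt (fun t => ‖X t - Y t‖ ^ 2
      + (1 / 2) * (∫ s in (0 : ℝ)..t, inner ℝ (B (X s)) (X s))
      - 2 * ∫ s in (0 : ℝ)..t, inner ℝ (B (Y s)) (Y s)) _ t := fun t =>
    ((hX.hasDerivAt_norm_sq_sub hG hinj hY t).add
      ((hasDerivAt_dissipation B hX.continuous t).const_mul (1 / 2))).sub
      ((hasDerivAt_dissipation B hY.continuous t).const_mul 2)
  have h := le_of_hasDerivAt_nonpos hd (fun t _ => ?_) le_rfl hT
  · simp only [hXY, sub_self, norm_zero, intervalIntegral.integral_same] at h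
    have := sq_nonneg ‖X T - Y T‖
    linarith
  · have h1 := inner_add_self_le hBs hB0 (X t - Y t) (Y t)
    rw [sub_add_cancel] at h1
    have h2 := neg_two_mul_inner_le hBs hB0 (Y t) (X t - Y t)
    have h3 : inner ℝ (B (X t)) (X t - Y t) =
        inner ℝ (B (X t - Y t)) (X t - Y t) + inner ℝ (B (Y t)) (X t - Y t) := by
      rw [← inner_add_left, ← map_add, sub_add_cancel]
    linarith

/-- With `W = X - Y`, `(‖W‖²)' ≤ ⟨B X, X⟩ + ‖B‖‖W‖²`, so Grönwall gives `‖W‖² ≤ e^{‖B‖T} I` on `[0,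
T]`. Then `⟨B Y, Y⟩ ≤ 2⟨B X, X⟩ + 2‖B‖‖W‖²` is integrated. No term absorbs the growth of `W` here,
whence the dependence on `T`. -/
theorem IsMild.le_dissipation (hG : IsSkew G) (hinj : Function.Injective G)
    (hBs : ∀ x y, inner ℝ (B x) y = inner ℝ x (B y)) (hB0 : ∀ x, 0 ≤ inner ℝ (B x) x)
    {X Y : ℝ → E} (hX : IsMild G (fun t => -B (X t)) X) (hY : IsMild G (fun _ => 0) Y)
    (hXY : X 0 = Y 0) {T : ℝ} (hT : 0 ≤ T) :
    ∫ t in (0 : ℝ)..T, inner ℝ (B (Y t)) (Y t) ≤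
      (2 + 2 * ‖B‖ * Real.exp (‖B‖ * T) * T) * ∫ t in (0 : ℝ)..T, inner ℝ (B (X t)) (X t) := by
  set b := ‖B‖ with hb
  set I := ∫ t in (0 : ℝ)..T, inner ℝ (B (X t)) (X t) with hI
  have hI0 : 0 ≤ I := intervalIntegral.integral_nonneg hT fun t _ => hB0 _
  have hexp : ∀ t, HasDerivAt (fun t : ℝ => Real.exp (-(b * t))) (-(b * Real.exp (-(b * t)))) t := by
    intro t
    exact (((hasDerivAt_id t).const_mul b).neg.exp).congr_deriv (by simp; ring)
  have hd : ∀ t, HasDerivAt (fun t => Real.exp (-(b * t)) * ‖X t - Y t‖ ^ 2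
      - ∫ s in (0 : ℝ)..t, inner ℝ (B (X s)) (X s)) _ t := fun t =>
    ((hexp t).mul (hX.hasDerivAt_norm_sq_sub hG hinj hY t)).sub
      (hasDerivAt_dissipation B hX.continuous t)
  have hW : ∀ t, 0 ≤ t → t ≤ T → ‖X t - Y t‖ ^ 2 ≤ Real.exp (b * T) * I := by
    intro t ht htT
    have h := le_of_hasDerivAt_nonpos hd (fun t ht => ?_) le_rfl ht
    · simp only [hXY, sub_self, norm_zero, intervalIntegral.integral_same] at h
      have h1 : ∫ s in (0 : ℝ)..t, inner ℝ (B (X s)) (X s) ≤ I :=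
        intervalIntegral.integral_mono_interval le_rfl ht htT
          (Eventually.of_forall fun s => hB0 _)
          ((continuous_inner_apply B hX.continuous).intervalIntegrable _ _)
      have h2 : Real.exp (b * T) * Real.exp (-(b * t)) ≥ 1 := by
        rw [← Real.exp_add]
        apply Real.one_le_exp
        have : b * t ≤ b * T := by gcongr
        linarith
      have h3 : Real.exp (-(b * t)) * ‖X t - Y t‖ ^ 2 ≤ I := by linarith
      calc ‖X t - Y t‖ ^ 2 ≤ Real.exp (b * T) * Real.exp (-(b * t)) * ‖X t - Y t‖ ^ 2 :=
            le_mul_of_one_le_left (by positivity) h2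
        _ = Real.exp (b * T) * (Real.exp (-(b * t)) * ‖X t - Y t‖ ^ 2) := by ring
        _ ≤ _ := by gcongr
    · have h1 := neg_two_mul_inner_le hBs hB0 (X t) (X t - Y t)
      have h2 := inner_apply_self_le B (X t - Y t)
      have h3 : Real.exp (-(b * t)) ≤ 1 := Real.exp_le_one_iff.2 (by
        have : 0 ≤ b * t := by positivity
        linarith)
      have h4 := Real.exp_pos (-(b * t))
      have h5 := hB0 (X t)
      rw [← hb] at h2
      nlinarith
  have h1 : ∫ t in (0 : ℝ)..T, inner ℝ (B (Y t)) (Y t) ≤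
      ∫ t in (0 : ℝ)..T, (2 * inner ℝ (B (X t)) (X t) + 2 * b * Real.exp (b * T) * I) := by
    refine intervalIntegral.integral_mono_on hT
      ((continuous_inner_apply B hY.continuous).intervalIntegrable _ _)
      ((((continuous_inner_apply B hX.continuous).const_mul 2).add
        continuous_const).intervalIntegrable _ _) fun t ht => ?_
    have h2 := inner_add_self_le hBs hB0 (X t) (Y t - X t)
    rw [add_sub_cancel] at h2
    have h3 := inner_apply_self_le B (Y t - X t)
    rw [norm_sub_rev] at h3
    have h4 : b * ‖X t - Y t‖ ^ 2 ≤ b * (Real.exp (b * T) * I) := by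
      gcongr
      exact hW t ht.1 ht.2
    rw [← hb] at h3
    linarith
  rw [intervalIntegral.integral_add
    (((continuous_inner_apply B hX.continuous).const_mul 2).intervalIntegrable _ _)
    (continuous_const.intervalIntegrable _ _), intervalIntegral.integral_const_mul,
    intervalIntegral.integral_const, ← hI, smul_eq_mul] at h1
  linarith

/-- Exponential stability of the damped equation is equivalent to the observability of the
undamped one, for classes of mild solutions with the same initial data. -/
theorem stabilization_iff_observability (hG : IsSkew G) (hinj : Function.Injective G)
    (hBs : ∀ x y, inner ℝ (B x) y = inner ℝ x (B y)) (hB0 : ∀ x, 0 ≤ inner ℝ (B x) x)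
    {SD SU : Set (ℝ → E)} (hD : ∀ X ∈ SD, IsMild G (fun t => -B (X t)) X)
    (hU : ∀ Y ∈ SU, IsMild G (fun _ => 0) Y)
    (hDU : ∀ X ∈ SD, ∀ τ, ∃ Y ∈ SU, Y 0 = X τ) (hUD : ∀ Y ∈ SU, ∃ X ∈ SD, X 0 = Y 0) :
    (∃ C₀ > (0 : ℝ), ∃ α > (0 : ℝ), ∀ X ∈ SD, ∀ t : ℝ, 0 ≤ t →
      ‖X t‖ ^ 2 ≤ C₀ * ‖X 0‖ ^ 2 * Real.exp (-α * t)) ↔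
    ∃ C > (0 : ℝ), ∃ T > (0 : ℝ), ∀ Y ∈ SU,
      ‖Y 0‖ ^ 2 ≤ C * ∫ t in (0 : ℝ)..T, inner ℝ (B (Y t)) (Y t) := by
  constructor
  · rintro ⟨C₀, hC₀, α, hα, h⟩
    obtain ⟨T, hT, hT2⟩ : ∃ T > (0 : ℝ), C₀ * Real.exp (-α * T) ≤ 1 / 2 := by
      have h1 : Tendsto (fun t : ℝ => C₀ * Real.exp (-α * t)) atTop (𝓝 (C₀ * 0)) := by
        refine (Real.tendsto_exp_atBot.comp ?_).const_mul C₀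
        exact tendsto_id.const_mul_atTop_of_neg (neg_lt_zero.2 hα)
      rw [mul_zero] at h1
      obtain ⟨T, h2, h3⟩ := ((h1.eventually_le_const (by norm_num : (0 : ℝ) < 1 / 2)).and
        (eventually_gt_atTop 0)).exists
      exact ⟨T, h3, h2⟩
    -- Half of the energy is lost by time `T`, so `‖X 0‖² ≤ 4 ∫⟨B X, X⟩`; comparison with `Y` costs
    -- another factor 4.
    refine ⟨16, by norm_num, T, hT, fun Y hY => ?_⟩
    obtain ⟨X, hX, hXY⟩ := hUD Y hY
    have h1 := h X hX T hT.le
    have h2 := (hD X hX).norm_sq_eq_damped hG hinj T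
    have h3 := (hD X hX).dissipation_le hG hinj hBs hB0 (hU Y hY) hXY hT.le
    have h4 : C₀ * ‖X 0‖ ^ 2 * Real.exp (-α * T) ≤ 1 / 2 * ‖X 0‖ ^ 2 := by
      nlinarith [sq_nonneg ‖X 0‖]
    rw [← hXY]
    nlinarith [sq_nonneg ‖X 0‖]
  · rintro ⟨C, hC, T, hT, h⟩
    -- Chosen so that observability and the comparison give `‖X t‖² ≤ κ (‖X t‖² - ‖X (t + T)‖²)`.
    set κ := C * (2 + 2 * ‖B‖ * Real.exp (‖B‖ * T) * T) / 2 with hκ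
    have hκ0 : 0 < κ := by positivity
    -- Since `‖X (t + T)‖ ≤ ‖X t‖`, the preceding inequality gives `(κ + 1)‖X (t + T)‖² ≤ κ‖X t‖²`;
    -- this ratio lies in `(0, 1)` for every `κ > 0`.
    obtain ⟨C₀, hC₀, α, hα, hdecay⟩ := exists_exp_decay (γ := κ / (κ + 1)) (T := T)
      (by positivity) (by rw [div_lt_one (by positivity)]; linarith) hT
    refine ⟨C₀, hC₀, α, hα, fun X hX => hdecay (fun t => ‖X t‖ ^ 2) (sq_nonneg _) ?_ ?_⟩
    · intro s t hs hst
      refine le_of_hasDerivAt_nonpos (fun t => (hD X hX).hasDerivAt_norm_sq_damped hG hinj t)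
        (fun t _ => ?_) hs hst
      linarith [hB0 (X t)]
    · intro t _
      -- The undamped solution is restarted from the damped state at time `t`, so data must be
      -- shared at all times and not only at 0.
      obtain ⟨Y, hY, hYX⟩ := hDU X hX t
      have hXt := (hD X hX).comp_add t
      have h1 := h Y hY
      have h2 := hXt.norm_sq_eq_damped hG hinj T
      have h3 := hXt.le_dissipation hG hinj hBs hB0 (hU Y hY) (by simp [hYX]) hT.le
      have h4 : 0 ≤ ∫ s in (0 : ℝ)..T, inner ℝ (B (X (s + t))) (X (s + t)) :=
        intervalIntegral.integral_nonneg hT.le fun s _ => hB0 _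
      simp only [zero_add] at h2
      rw [add_comm T t] at h2
      have h5 : C * ∫ s in (0 : ℝ)..T, inner ℝ (B (Y s)) (Y s) ≤
          κ * (2 * ∫ s in (0 : ℝ)..T, inner ℝ (B (X (s + t))) (X (s + t))) :=
        (mul_le_mul_of_nonneg_left h3 hC.le).trans_eq (by rw [hκ]; ring)
      rw [hYX] at h1
      rw [div_mul_eq_mul_div, le_div_iff₀ (by positivity)]
      nlinarith

end Equivalence

/-! ### The abstract damped wave equation attached to an embedding `J`. -/

section Wave

variable {F K : Type*} [NormedAddCommGroup F] [InnerProductSpace ℝ F]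
  [NormedAddCommGroup K] [InnerProductSpace ℝ K]

open ContinuousLinearMap in
/-- The damping operator `(f, g) ↦ (0, b g)`. -/
def dampOp (F : Type*) [NormedAddCommGroup F] [InnerProductSpace ℝ F] (b : K →L[ℝ] K) :
    WithLp 2 (F × K) →L[ℝ] WithLp 2 (F × K) :=
  ((WithLp.prodContinuousLinearEquiv 2 ℝ F K).symm : F × K →L[ℝ] WithLp 2 (F × K)).comp
    (((0 : F × K →L[ℝ] F).prod (b.comp (snd ℝ F K))).comp
      (WithLp.prodContinuousLinearEquiv 2 ℝ F K : WithLp 2 (F × K) →L[ℝ] F × K))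

theorem dampOp_apply (b : K →L[ℝ] K) (x : WithLp 2 (F × K)) :
    dampOp F b x = WithLp.toLp 2 (0, b x.snd) := rfl

theorem inner_dampOp (b : K →L[ℝ] K) (x y : WithLp 2 (F × K)) :
    inner ℝ (dampOp F b x) y = inner ℝ (b x.snd) y.snd := by
  rw [dampOp_apply, WithLp.prod_inner_apply]
  simp

theorem inner_dampOp_comm {b : K →L[ℝ] K} (hb : ∀ x y, inner ℝ (b x) y = inner ℝ x (b y))
    (x y : WithLp 2 (F × K)) : inner ℝ (dampOp F b x) y = inner ℝ x (dampOp F b y) := by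
  rw [← real_inner_comm x, inner_dampOp, inner_dampOp, hb, real_inner_comm]

theorem hasDerivAt_withLp_prod_iff {X : ℝ → WithLp 2 (F × K)} {X' : WithLp 2 (F × K)} {t : ℝ} :
    HasDerivAt X X' t ↔
      HasDerivAt (fun s => (X s).fst) X'.fst t ∧ HasDerivAt (fun s => (X s).snd) X'.snd t := by
  constructor
  · intro h
    have h1 := (WithLp.prodContinuousLinearEquiv 2 ℝ F K).hasFDerivAt.comp_hasDerivAt t h
    exact ⟨(ContinuousLinearMap.fst ℝ F K).hasFDerivAt.comp_hasDerivAt t h1,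
      (ContinuousLinearMap.snd ℝ F K).hasFDerivAt.comp_hasDerivAt t h1⟩
  · rintro ⟨h1, h2⟩
    exact (WithLp.prodContinuousLinearEquiv 2 ℝ F K).symm.hasFDerivAt.comp_hasDerivAt t
      (h1.prodMk h2)

theorem continuous_withLp_prod_iff {X : ℝ → WithLp 2 (F × K)} :
    Continuous X ↔ Continuous (fun s => (X s).fst) ∧ Continuous (fun s => (X s).snd) := by
  constructor
  · intro h
    have h1 := (WithLp.prodContinuousLinearEquiv 2 ℝ F K).continuous.comp h
    exact ⟨continuous_fst.comp h1, continuous_snd.comp h1⟩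
  · rintro ⟨h1, h2⟩
    exact (WithLp.prodContinuousLinearEquiv 2 ℝ F K).symm.continuous.comp (h1.prodMk h2)

/-- Each scalar derivative integrates to `⟨f s, w⟩ = ⟨f 0 + ∫ f', w⟩`, so `f` is a primitive of the
continuous `f'`. Weak differentiability thus becomes strong. -/
theorem hasDerivAt_of_forall_inner [CompleteSpace F] {f f' : ℝ → F} (hf' : Continuous f')
    (h : ∀ w t, HasDerivAt (fun s => inner ℝ (f s) w) (inner ℝ (f' t) w) t) (t : ℝ) :
    HasDerivAt f (f' t) t := by
  have h1 : ∀ s, f s = f 0 + ∫ r in (0 : ℝ)..s, f' r := by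
    intro s
    refine ext_inner_right ℝ fun w => ?_
    have h2 := intervalIntegral.integral_eq_sub_of_hasDerivAt (a := 0) (b := s)
      (fun r _ => h w r) ((hf'.inner continuous_const).intervalIntegrable _ _)
    have h3 := ContinuousLinearMap.intervalIntegral_comp_comm (innerSL ℝ w)
      (hf'.intervalIntegrable (μ := volume) 0 s)
    simp only [innerSL_apply_apply, real_inner_comm _ w] at h3
    rw [inner_add_left, ← h3, h2]
    ring
  exact ((hf'.integral_hasStrictDerivAt 0 t).hasDerivAt.const_add (f 0)).congr_of_eventuallyEq
    (Eventually.of_forall h1)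

variable [CompleteSpace F] [CompleteSpace K]

open ContinuousLinearMap in
/-- The inverse `(f, g) ↦ (-J* g, J f)` of the wave operator attached to `J`. -/
def waveOp (J : F →L[ℝ] K) : WithLp 2 (F × K) →L[ℝ] WithLp 2 (F × K) :=
  ((WithLp.prodContinuousLinearEquiv 2 ℝ F K).symm : F × K →L[ℝ] WithLp 2 (F × K)).comp
    ((((-(adjoint J)).comp (snd ℝ F K)).prod (J.comp (fst ℝ F K))).comp
      (WithLp.prodContinuousLinearEquiv 2 ℝ F K : WithLp 2 (F × K) →L[ℝ] F × K))

theorem waveOp_apply (J : F →L[ℝ] K) (x : WithLp 2 (F × K)) :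
    waveOp J x = WithLp.toLp 2 (-(ContinuousLinearMap.adjoint J x.snd), J x.fst) := rfl

theorem isSkew_waveOp (J : F →L[ℝ] K) : IsSkew (waveOp J) := by
  intro x y
  simp only [waveOp_apply, WithLp.prod_inner_apply]
  rw [inner_neg_left, inner_neg_right, ContinuousLinearMap.adjoint_inner_left,
    ContinuousLinearMap.adjoint_inner_right]
  change -inner ℝ x.snd (J y.fst) + inner ℝ (J x.fst) y.snd =
    -(-inner ℝ (J x.fst) y.snd + inner ℝ x.snd (J y.fst))
  ring

/-- Density of the range of `J` is injectivity of `J*`. -/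
theorem injective_waveOp {J : F →L[ℝ] K} (hinj : Function.Injective J) (hden : DenseRange J) :
    Function.Injective (waveOp J) := by
  rw [injective_iff_map_eq_zero]
  intro x hx
  rw [waveOp_apply] at hx
  have h := congrArg WithLp.ofLp hx
  have h1 : -(ContinuousLinearMap.adjoint J x.snd) = 0 := congrArg Prod.fst h
  have h2 : J x.fst = 0 := congrArg Prod.snd h
  have h3 : x.fst = 0 := hinj (by rw [h2, map_zero])
  have h4 : x.snd = 0 := by
    rw [← inner_self_eq_zero (𝕜 := ℝ)]
    refine hden.induction_on (p := fun w => inner ℝ x.snd w = 0) x.snd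
      (isClosed_eq (continuous_const.inner continuous_id) continuous_const) fun v => ?_
    rw [neg_eq_zero] at h1
    rw [← ContinuousLinearMap.adjoint_inner_left, h1, inner_zero_left]
  exact WithLp.ofLp_injective 2 (Prod.ext h3 h4)

/-- Mild solutions of the damped wave equation are its weak solutions. -/
theorem isMild_waveOp_iff {J : F →L[ℝ] K} {b : K →L[ℝ] K} {X : ℝ → WithLp 2 (F × K)} :
    IsMild (waveOp J) (fun t => -dampOp F b (X t)) X ↔
      Continuous X ∧ (∀ t, HasDerivAt (fun s => J (X s).fst) (X t).snd t) ∧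
      ∀ w t, HasDerivAt (fun s => inner ℝ (X s).snd (J w))
        (-inner ℝ (X t).fst w - inner ℝ (b (X t).snd) (J w)) t := by
  have key : ∀ t, X t + waveOp J (-dampOp F b (X t)) = WithLp.toLp 2
      ((X t).fst + ContinuousLinearMap.adjoint J (b (X t).snd), (X t).snd) := by
    intro t
    apply WithLp.ofLp_injective 2
    rw [map_neg, waveOp_apply, dampOp_apply]
    ext <;> simp
  constructor
  · rintro ⟨hc, hd⟩
    refine ⟨hc, fun t => ?_, fun w t => ?_⟩
    · have h := hd t
      rw [key] at h
      exact (hasDerivAt_withLp_prod_iff.1 h).2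
    · have h := hd t
      rw [key] at h
      have h1 := (hasDerivAt_withLp_prod_iff.1 h).1
      have h2 := (h1.inner ℝ (hasDerivAt_const t w)).neg
      refine (h2.congr_of_eventuallyEq (Eventually.of_forall fun s => ?_)).congr_deriv ?_
      · change _ = -inner ℝ (-(ContinuousLinearMap.adjoint J (X s).snd)) w
        rw [inner_neg_left, neg_neg, ContinuousLinearMap.adjoint_inner_left]
      · change -(inner ℝ _ 0 + inner ℝ ((X t).fst +
          ContinuousLinearMap.adjoint J (b (X t).snd)) w) = _
        rw [inner_zero_right, inner_add_left, ContinuousLinearMap.adjoint_inner_left]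
        ring
  · rintro ⟨hc, h1, h2⟩
    refine ⟨hc, fun t => ?_⟩
    rw [key, hasDerivAt_withLp_prod_iff]
    refine ⟨?_, h1 t⟩
    have hc' := continuous_withLp_prod_iff.1 hc
    refine hasDerivAt_of_forall_inner
      (f := fun s => -(ContinuousLinearMap.adjoint J (X s).snd))
      (f' := fun s => (X s).fst + ContinuousLinearMap.adjoint J (b (X s).snd))
      (hc'.1.add ((ContinuousLinearMap.adjoint J).continuous.comp (b.continuous.comp hc'.2)))
      (fun w t => ?_) t
    simp only [inner_neg_left, inner_add_left, ContinuousLinearMap.adjoint_inner_left]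
    exact (h2 w t).neg.congr_deriv (by ring)

/-- Regular solutions of the damped wave equation, for initial data in the domain of the wave
operator. -/
theorem exists_isMild_waveOp_regular {J : F →L[ℝ] K} (hinj : Function.Injective J)
    (hden : DenseRange J) (b : K →L[ℝ] K) (f₀ : F) (h₀ : K) :
    ∃ X Y : ℝ → WithLp 2 (F × K),
      X 0 = WithLp.toLp 2 (ContinuousLinearMap.adjoint J h₀, J f₀) ∧
      IsMild (waveOp J) (fun t => -dampOp F b (X t)) X ∧ Continuous Y ∧
      (∀ t, HasDerivAt X (Y t) t) ∧ (∀ t, (X t).snd = J (Y t).fst) ∧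
      ∀ t w, inner ℝ (X t).fst w = -inner ℝ ((Y t).snd + b (X t).snd) (J w) := by
  -- `Y` is to be the derivative of the desired solution, so it starts from `(A - B)` applied to the
  -- data `(J* h₀, J f₀)`.
  obtain ⟨Y, hY0, hY⟩ := exists_isMild (isSkew_waveOp J) (injective_waveOp hinj hden)
    (dampOp F b) (WithLp.toLp 2 (f₀, -(h₀ + b (J f₀))))
  obtain ⟨hc, h1, h2⟩ := isMild_waveOp_iff.1 hY
  have hc' := continuous_withLp_prod_iff.1 hc
  -- `X = (A - B)⁻¹ Y`, read off the equation `X' = (A - B) X` with `Y` in place of `X'`.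
  set X : ℝ → WithLp 2 (F × K) := fun t => WithLp.toLp 2
    (-(ContinuousLinearMap.adjoint J ((Y t).snd + b (J (Y t).fst))), J (Y t).fst) with hX
  have hinner : ∀ t w, inner ℝ (X t).fst w = -inner ℝ ((Y t).snd + b (X t).snd) (J w) := by
    intro t w
    change inner ℝ (-(ContinuousLinearMap.adjoint J ((Y t).snd + b (J (Y t).fst)))) w = _
    rw [inner_neg_left, ContinuousLinearMap.adjoint_inner_left]
    rfl
  have hXd : ∀ t, HasDerivAt X (Y t) t := by
    intro t
    rw [hasDerivAt_withLp_prod_iff]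
    refine ⟨?_, h1 t⟩
    refine hasDerivAt_of_forall_inner (f' := fun s => (Y s).fst) hc'.1 (fun w t => ?_) t
    have h3 : HasDerivAt (fun s => inner ℝ (b (J (Y s).fst)) (J w))
        (inner ℝ (b (Y t).snd) (J w)) t := by
      simpa using (b.hasFDerivAt.comp_hasDerivAt t (h1 t)).inner ℝ (hasDerivAt_const t (J w))
    refine (((h2 w t).add h3).neg.congr_of_eventuallyEq
      (Eventually.of_forall fun s => ?_)).congr_deriv (by ring)
    rw [hinner, inner_add_left]
    rfl
  refine ⟨X, Y, ?_, ?_, hc, hXd, fun t => rfl, hinner⟩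
  · simp [hX, hY0]
  · refine isMild_waveOp_iff.2 ⟨continuous_iff_continuousAt.2 fun t => (hXd t).continuousAt,
      fun t => ?_, fun w t => ?_⟩
    · exact J.hasFDerivAt.comp_hasDerivAt t (hasDerivAt_withLp_prod_iff.1 (hXd t)).1
    · have h3 := (hasDerivAt_withLp_prod_iff.1 (hXd t)).2.inner ℝ (hasDerivAt_const t (J w))
      refine h3.congr_deriv ?_
      rw [hinner, inner_zero_right, inner_add_left]
      ring

end Wave

/-! ### Weak derivatives, Green's formula and Poincaré's inequality. -/

section WeakDerivatives

variable {d : ℕ} {Ω : Set (Rd d)}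

/-- Integration of square integrable functions against a fixed square integrable weight. -/
def pairing {F : Type*} [NormedAddCommGroup F] [NormedSpace ℝ F] [CompleteSpace F] (ψ : L2s Ω) :
    Lp F 2 (volume.restrict Ω) →L[ℝ] F :=
  (ContinuousLinearMap.lsmul ℝ ℝ).lpPairing (volume.restrict Ω) 2 2 ψ

theorem pairing_apply {F : Type*} [NormedAddCommGroup F] [NormedSpace ℝ F] [CompleteSpace F]
    {ψ : Rd d → ℝ}
    (hψ : MemLp ψ 2 (volume.restrict Ω)) (f : Lp F 2 (volume.restrict Ω)) :
    pairing (hψ.toLp ψ) f = ∫ x in Ω, ψ x • f x := by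
  rw [pairing, ContinuousLinearMap.lpPairing_eq_integral]
  refine integral_congr_ae ?_
  filter_upwards [hψ.coeFn_toLp] with x hx
  simp [hx]

/-- `ψ` is a smooth function compactly supported in `Ω`. -/
structure IsTest {F : Type*} [NormedAddCommGroup F] [NormedSpace ℝ F] (Ω : Set (Rd d))
    (ψ : Rd d → F) : Prop where
  contDiff : ContDiff ℝ ∞ ψ
  hasCompactSupport : HasCompactSupport ψ
  tsupport_subset : tsupport ψ ⊆ Ω

namespace IsTest

variable {F : Type*} [NormedAddCommGroup F] [NormedSpace ℝ F] {ψ : Rd d → F}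

theorem differentiable (h : IsTest Ω ψ) : Differentiable ℝ ψ :=
  h.contDiff.differentiable (by simp)

theorem continuous_fderiv_apply (h : IsTest Ω ψ) (v : Rd d) :
    Continuous fun x => fderiv ℝ ψ x v :=
  (h.contDiff.continuous_fderiv (by simp)).clm_apply continuous_const

theorem hasCompactSupport_fderiv_apply (h : IsTest Ω ψ) (v : Rd d) :
    HasCompactSupport fun x => fderiv ℝ ψ x v :=
  h.hasCompactSupport.fderiv_apply (𝕜 := ℝ) v

theorem eq_zero (h : IsTest Ω ψ) {x : Rd d} (hx : x ∉ Ω) : ψ x = 0 :=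
  image_eq_zero_of_notMem_tsupport fun hx' => hx (h.tsupport_subset hx')

theorem fderiv_eq_zero (h : IsTest Ω ψ) (v : Rd d) {x : Rd d} (hx : x ∉ Ω) :
    fderiv ℝ ψ x v = 0 := by
  have : x ∉ tsupport (fun x => fderiv ℝ ψ x v) := fun hx' =>
    hx (h.tsupport_subset (tsupport_fderiv_apply_subset ℝ v hx'))
  exact image_eq_zero_of_notMem_tsupport (f := fun x => fderiv ℝ ψ x v) this

theorem memLp (h : IsTest Ω ψ) : MemLp ψ 2 (volume.restrict Ω) :=
  (h.contDiff.continuous.memLp_of_hasCompactSupport h.hasCompactSupport).restrict _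

theorem memLp_fderiv (h : IsTest Ω ψ) (v : Rd d) :
    MemLp (fun x => fderiv ℝ ψ x v) 2 (volume.restrict Ω) :=
  ((h.continuous_fderiv_apply v).memLp_of_hasCompactSupport
    (h.hasCompactSupport_fderiv_apply v)).restrict _

theorem add {χ : Rd d → F} (h : IsTest Ω ψ) (h' : IsTest Ω χ) :
    IsTest Ω (fun x => ψ x + χ x) where
  contDiff := h.contDiff.add h'.contDiff
  hasCompactSupport := h.hasCompactSupport.add h'.hasCompactSupport
  tsupport_subset := (tsupport_add ψ χ).trans (union_subset h.tsupport_subset h'.tsupport_subset)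

theorem const_smul (h : IsTest Ω ψ) (c : ℝ) : IsTest Ω (fun x => c • ψ x) where
  contDiff := h.contDiff.const_smul c
  hasCompactSupport := h.hasCompactSupport.smul_left (f := fun _ => c)
  tsupport_subset := (tsupport_smul_subset_right (fun _ => c) ψ).trans h.tsupport_subset

end IsTest

theorem IsTest.clm_comp {F F' : Type*} [NormedAddCommGroup F] [NormedSpace ℝ F]
    [NormedAddCommGroup F'] [NormedSpace ℝ F'] {ψ : Rd d → F} (h : IsTest Ω ψ) (L : F →L[ℝ] F') :
    IsTest Ω (fun x => L (ψ x)) where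
  contDiff := L.contDiff.comp h.contDiff
  hasCompactSupport := h.hasCompactSupport.comp_left (g := L) (map_zero L)
  tsupport_subset := (closure_mono (Function.support_comp_subset (map_zero L) ψ)).trans
    h.tsupport_subset

theorem fderiv_clm_comp {F F' : Type*} [NormedAddCommGroup F] [NormedSpace ℝ F]
    [NormedAddCommGroup F'] [NormedSpace ℝ F'] {ψ : Rd d → F} (h : IsTest Ω ψ) (L : F →L[ℝ] F')
    (x v : Rd d) : fderiv ℝ (fun x => L (ψ x)) x v = L (fderiv ℝ ψ x v) := by
  have := (L.hasFDerivAt.comp x (h.differentiable x).hasFDerivAt).fderiv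
  change fderiv ℝ (L ∘ ψ) x v = _
  rw [this]; rfl

theorem mem_testJets_iff {j : Jet Ω} : j ∈ testJets Ω ↔ ∃ φ : Rd d → Rd d, IsTest Ω φ ∧
    (∀ᵐ x ∂(volume.restrict Ω), j.1 x = φ x) ∧
    ∀ i : Fin d, ∀ᵐ x ∂(volume.restrict Ω), j.2 i x = fderiv ℝ φ x (e i) :=
  ⟨fun ⟨φ, h1, h2, h3, h4, h5⟩ => ⟨φ, ⟨h1, h2, h3⟩, h4, h5⟩,
    fun ⟨φ, ⟨h1, h2, h3⟩, h4, h5⟩ => ⟨φ, h1, h2, h3, h4, h5⟩⟩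

theorem span_testJets : (Submodule.span ℝ (testJets Ω) : Set (Jet Ω)) = testJets Ω := by
  refine Subset.antisymm (fun j hj => ?_) Submodule.subset_span
  refine Submodule.span_induction (p := fun j _ => j ∈ testJets Ω) (fun _ h => h) ?_ ?_ ?_ hj
  · refine mem_testJets_iff.2 ⟨0, ⟨contDiff_const, HasCompactSupport.zero, ?_⟩, ?_, fun i => ?_⟩
    · simp [tsupport]
    · exact Lp.coeFn_zero (Rd d) 2 _
    · filter_upwards [Lp.coeFn_zero (Rd d) 2 (volume.restrict Ω)] with x hx
      exact hx.trans (by simp)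
  · rintro j k - - hj hk
    obtain ⟨φ, hφ, h1, h2⟩ := mem_testJets_iff.1 hj
    obtain ⟨χ, hχ, h3, h4⟩ := mem_testJets_iff.1 hk
    refine mem_testJets_iff.2 ⟨_, hφ.add hχ, ?_, fun i => ?_⟩
    · filter_upwards [h1, h3, Lp.coeFn_add j.1 k.1] with x h1 h3 h
      change (j.1 + k.1) x = _
      rw [h, Pi.add_apply, h1, h3]
    · filter_upwards [h2 i, h4 i, Lp.coeFn_add (j.2 i) (k.2 i)] with x h1 h3 h
      change (j.2 i + k.2 i) x = _
      rw [h, Pi.add_apply, h1, h3, fderiv_fun_add (hφ.differentiable x) (hχ.differentiable x)]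
      rfl
  · rintro c j - hj
    obtain ⟨φ, hφ, h1, h2⟩ := mem_testJets_iff.1 hj
    refine mem_testJets_iff.2 ⟨_, hφ.const_smul c, ?_, fun i => ?_⟩
    · filter_upwards [h1, Lp.coeFn_smul c j.1] with x h1 h
      change (c • j.1) x = _
      rw [h, Pi.smul_apply, h1]
    · filter_upwards [h2 i, Lp.coeFn_smul c (j.2 i)] with x h1 h
      change (c • j.2 i) x = _
      rw [h, Pi.smul_apply, h1, fderiv_fun_const_smul (hφ.differentiable x)]
      rfl

/-- Closed properties of the elements of `H¹₀` may be checked on test fields. -/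
theorem H10_induction {P : Jet Ω → Prop} (hP : IsClosed {j | P j})
    (h : ∀ (j : Jet Ω) (φ : Rd d → Rd d), IsTest Ω φ → (j.1 : Rd d → Rd d) =ᵐ[volume.restrict Ω] φ →
      (∀ i, (j.2 i : Rd d → Rd d) =ᵐ[volume.restrict Ω] fun x => fderiv ℝ φ x (e i)) → P j)
    {j : Jet Ω} (hj : j ∈ H10 Ω) : P j := by
  have h1 : (H10 Ω : Set (Jet Ω)) = closure (testJets Ω) := by
    rw [H10, Submodule.topologicalClosure_coe, span_testJets]
  have h2 : closure (testJets Ω) ⊆ {j | P j} := by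
    refine closure_minimal (fun j hj => ?_) hP
    obtain ⟨φ, hφ, h3, h4⟩ := mem_testJets_iff.1 hj
    exact h j φ hφ h3 h4
  exact h2 (h1 ▸ hj)

theorem hasWeakPartial_iff {F : Type*} [NormedAddCommGroup F] [NormedSpace ℝ F]
    [CompleteSpace F] {i : Fin d}
    {f g : Lp F 2 (volume.restrict Ω)} :
    HasWeakPartial Ω i (fun x => f x) (fun x => g x) ↔ ∀ (ψ : Rd d → ℝ) (hψ : IsTest Ω ψ),
      pairing ((hψ.memLp_fderiv (e i)).toLp _) f = -pairing (hψ.memLp.toLp _) g := by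
  simp only [pairing_apply]
  exact ⟨fun h ψ hψ => h ψ hψ.1 hψ.2 hψ.3, fun h ψ h1 h2 h3 => h ψ ⟨h1, h2, h3⟩⟩

theorem HasWeakPartial.congr {F : Type*} [NormedAddCommGroup F] [NormedSpace ℝ F] {i : Fin d}
    {f g f' g' : Rd d → F} (h : HasWeakPartial Ω i f g) (hf : f =ᵐ[volume.restrict Ω] f')
    (hg : g =ᵐ[volume.restrict Ω] g') : HasWeakPartial Ω i f' g' := by
  intro φ h1 h2 h3
  have h4 := h φ h1 h2 h3
  rw [integral_congr_ae (hf.mono fun x hx => by rw [hx] :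
      ∀ᵐ x ∂(volume.restrict Ω), fderiv ℝ φ x (e i) • f x = fderiv ℝ φ x (e i) • f' x),
    integral_congr_ae (hg.mono fun x hx => by rw [hx] :
      ∀ᵐ x ∂(volume.restrict Ω), φ x • g x = φ x • g' x)] at h4
  exact h4

theorem isClosed_hasWeakPartial {F : Type*} [NormedAddCommGroup F] [NormedSpace ℝ F]
    [CompleteSpace F] (i : Fin d) : IsClosed {q : Lp F 2 (volume.restrict Ω) × Lp F 2 (volume.restrict Ω) |
      HasWeakPartial Ω i (fun x => q.1 x) (fun x => q.2 x)} := by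
  simp only [hasWeakPartial_iff, Set.ofPred_forall]
  refine isClosed_iInter fun ψ => isClosed_iInter fun hψ => ?_
  exact isClosed_eq ((pairing _).continuous.comp continuous_fst)
    ((pairing _).continuous.comp continuous_snd).neg

/-- The difference of two weak derivatives integrates to zero against all test functions, so it
vanishes by the fundamental lemma of the calculus of variations. -/
theorem HasWeakPartial.unique {F : Type*} [NormedAddCommGroup F] [NormedSpace ℝ F]
    [CompleteSpace F] (hΩ : IsOpen Ω) {i : Fin d} {f g g' : Lp F 2 (volume.restrict Ω)}
    (h : HasWeakPartial Ω i (fun x => f x) (fun x => g x))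
    (h' : HasWeakPartial Ω i (fun x => f x) (fun x => g' x)) : g = g' := by
  rw [hasWeakPartial_iff] at h h'
  rw [← sub_eq_zero, Lp.eq_zero_iff_ae_eq_zero]
  have h1 := IsOpen.ae_eq_zero_of_integral_contDiff_smul_eq_zero (μ := volume.restrict Ω) hΩ
    (f := fun x => (g - g') x)
    (((Lp.memLp (g - g')).locallyIntegrable (by norm_num)).locallyIntegrableOn _)
    (fun ψ h1 h2 h3 => by
      have hψ : IsTest Ω ψ := ⟨h1, h2, h3⟩
      rw [← pairing_apply hψ.memLp, map_sub, sub_eq_zero]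
      exact neg_injective ((h ψ hψ).symm.trans (h' ψ hψ)))
  filter_upwards [h1, ae_restrict_mem hΩ.measurableSet] with x hx hxΩ
  exact hx hxΩ

theorem setIntegral_eq_integral_of_isTest {F : Type*} [NormedAddCommGroup F] [NormedSpace ℝ F]
    {f : Rd d → F} (h : ∀ x, x ∉ Ω → f x = 0) : ∫ x in Ω, f x = ∫ x, f x :=
  setIntegral_eq_integral_of_forall_compl_eq_zero h

/-- The partial derivatives carried by an element of `H¹₀` are its weak derivatives. -/
theorem hasWeakPartial_of_mem_H10 {w : Jet Ω} (hw : w ∈ H10 Ω) (i : Fin d) :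
    HasWeakPartial Ω i (fun x => w.1 x) (fun x => w.2 i x) := by
  refine H10_induction (P := fun w => HasWeakPartial Ω i (fun x => w.1 x) (fun x => w.2 i x))
    ?_ ?_ hw
  · exact IsClosed.preimage (f := fun w : Jet Ω => (w.1, w.2 i))
      (continuous_fst.prodMk ((continuous_apply i).comp continuous_snd))
      (isClosed_hasWeakPartial i)
  · intro j φ hφ h1 h2
    refine HasWeakPartial.congr ?_ h1.symm (h2 i).symm
    intro ψ h3 h4 h5
    have hψ : IsTest Ω ψ := ⟨h3, h4, h5⟩
    -- Test fields vanish off `Ω`, so the integration by parts takes place on the whole space and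
    -- the boundary of `Ω` plays no role.
    rw [setIntegral_eq_integral_of_isTest fun x hx => by simp [hφ.eq_zero hx],
      setIntegral_eq_integral_of_isTest fun x hx => by simp [hψ.eq_zero hx]]
    rw [integral_smul_fderiv_eq_neg_fderiv_smul_of_integrable, neg_neg]
    · exact ((hψ.continuous_fderiv_apply _).smul hφ.contDiff.continuous).integrable_of_hasCompactSupport
        (hφ.hasCompactSupport.smul_left)
    · exact (hψ.contDiff.continuous.smul (hφ.continuous_fderiv_apply _)).integrable_of_hasCompactSupport
        (hψ.hasCompactSupport.smul_right)
    · exact (hψ.contDiff.continuous.smul hφ.contDiff.continuous).integrable_of_hasCompactSupport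
        (hψ.hasCompactSupport.smul_right)
    · exact fun x _ => hψ.differentiable x
    · exact fun x _ => hφ.differentiable x

/-- The `k`-th component of a square integrable vector field. -/
def comp (Ω : Set (Rd d)) (k : Fin d) : L2 Ω →L[ℝ] L2s Ω :=
  (EuclideanSpace.proj k : Rd d →L[ℝ] ℝ).compLpL 2 (volume.restrict Ω)

theorem coeFn_comp (k : Fin d) (f : L2 Ω) :
    (comp Ω k f : Rd d → ℝ) =ᵐ[volume.restrict Ω] fun x => f x k :=
  (EuclideanSpace.proj k : Rd d →L[ℝ] ℝ).coeFn_compLpL f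

theorem inner_eq_sum_comp (f g : L2 Ω) :
    inner ℝ f g = ∑ k, inner ℝ (comp Ω k f) (comp Ω k g) := by
  simp only [L2.inner_def]
  rw [← integral_finsetSum _ fun k _ => L2.integrable_inner _ _]
  refine integral_congr_ae ?_
  filter_upwards [ae_all_iff.2 fun k => coeFn_comp k f, ae_all_iff.2 fun k => coeFn_comp k g]
    with x hf hg
  simp [hf, hg, PiLp.inner_apply]

theorem HasWeakPartial.comp {i : Fin d} {f g : L2 Ω}
    (h : HasWeakPartial Ω i (fun x => f x) (fun x => g x)) (k : Fin d) :
    HasWeakPartial Ω i (fun x => comp Ω k f x) (fun x => comp Ω k g x) := by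
  have key : ∀ (ψ : Rd d → ℝ) (hψ : MemLp ψ 2 (volume.restrict Ω)) (f : L2 Ω),
      pairing (hψ.toLp ψ) (HypStokes.comp Ω k f) = pairing (hψ.toLp ψ) f k := by
    intro ψ hψ f
    rw [pairing_apply, pairing_apply]
    have h1 := ContinuousLinearMap.integral_comp_comm (EuclideanSpace.proj k : Rd d →L[ℝ] ℝ)
      (φ := fun x => ψ x • f x) (μ := volume.restrict Ω) 
      (memLp_one_iff_integrable.1 ((Lp.memLp f).smul hψ))
    refine Eq.trans (integral_congr_ae ?_) h1
    filter_upwards [coeFn_comp k f] with x hx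
    simp [hx]
  rw [hasWeakPartial_iff] at h ⊢
  intro ψ hψ
  rw [key, key, h ψ hψ]
  rfl

/-- Green's formula for a function in `H¹` and a field in `H¹₀`. -/
theorem inner_comp_eq_neg {i : Fin d} {f g : L2s Ω}
    (h : HasWeakPartial Ω i (fun x => f x) (fun x => g x)) {w : Jet Ω} (hw : w ∈ H10 Ω)
    (k : Fin d) : inner ℝ f (comp Ω k (w.2 i)) = -inner ℝ g (comp Ω k w.1) := by
  refine H10_induction (P := fun w => inner ℝ f (comp Ω k (w.2 i)) = -inner ℝ g (comp Ω k w.1))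
    ?_ ?_ hw
  · refine isClosed_eq ?_ ?_
    · exact continuous_const.inner ((comp Ω k).continuous.comp
        ((continuous_apply i).comp continuous_snd))
    · exact (continuous_const.inner ((comp Ω k).continuous.comp continuous_fst)).neg
  · intro j φ hφ h1 h2
    have hφk : IsTest Ω (fun x => φ x k) := hφ.clm_comp (EuclideanSpace.proj k : Rd d →L[ℝ] ℝ)
    have h3 := h _ hφk.1 hφk.2 hφk.3
    rw [L2.inner_def, L2.inner_def]
    have h4 : ∀ x, fderiv ℝ (fun x => φ x k) x (e i) = (fderiv ℝ φ x (e i)) k := fun x =>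
      fderiv_clm_comp hφ (EuclideanSpace.proj k : Rd d →L[ℝ] ℝ) x (e i)
    refine Eq.trans (integral_congr_ae ?_) (h3.trans (congrArg Neg.neg (integral_congr_ae ?_)))
    · filter_upwards [coeFn_comp k (j.2 i), h2 i] with x h5 h6
      simp [h5, h6, h4]
    · filter_upwards [coeFn_comp k j.1, h1] with x h5 h6
      simp [h5, h6]

theorem inner_eq_neg_inner {i : Fin d} {f g : L2 Ω}
    (h : HasWeakPartial Ω i (fun x => f x) (fun x => g x)) {w : Jet Ω} (hw : w ∈ H10 Ω) :
    inner ℝ f (w.2 i) = -inner ℝ g w.1 := by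
  rw [inner_eq_sum_comp, inner_eq_sum_comp, ← Finset.sum_neg_distrib]
  exact Finset.sum_congr rfl fun k _ => inner_comp_eq_neg (h.comp k) hw k

/-- The divergence of a jet. -/
def divL (Ω : Set (Rd d)) : Jet Ω →L[ℝ] L2s Ω :=
  ∑ i, (comp Ω i).comp ((ContinuousLinearMap.proj i).comp (ContinuousLinearMap.snd ℝ _ _))

theorem divL_apply (j : Jet Ω) : divL Ω j = ∑ i, comp Ω i (j.2 i) := by
  simp [divL]

theorem mem_divFree_iff {j : Jet Ω} : j ∈ divFree Ω ↔ divL Ω j = 0 := by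
  rw [Lp.eq_zero_iff_ae_eq_zero, divL_apply]
  have h : (∑ i, comp Ω i (j.2 i) : L2s Ω) =ᵐ[volume.restrict Ω]
      fun x => ∑ i, (j.2 i x) i := by
    filter_upwards [Lp.coeFn_finsetSum Finset.univ fun i => comp Ω i (j.2 i),
      ae_all_iff.2 fun i => coeFn_comp i (j.2 i)] with x h1 h2
    rw [h1]
    simp [h2]
  exact ⟨fun h1 => h.trans h1, fun h1 => h.symm.trans h1⟩

/-- Green's formula moves the gradient onto the divergence of `u`, which is zero. This both
eliminates the pressure and puts `V` inside `H`. -/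
theorem inner_gradient_eq_zero {p : L2s Ω} {G : L2 Ω} (h : HasWeakGradient Ω p G) (u : V Ω) :
    inner ℝ (fld u) G = 0 := by
  have h1 : divL Ω u = 0 := mem_divFree_iff.1 u.2.2
  rw [real_inner_comm, inner_eq_sum_comp]
  have h2 : ∀ i, inner ℝ (comp Ω i G) (comp Ω i (fld u)) =
      -inner ℝ p (comp Ω i ((u : Jet Ω).2 i)) := by
    intro i
    rw [inner_comp_eq_neg (g := comp Ω i G) ((h i).congr (ae_eq_refl _) (coeFn_comp i G).symm)
      u.2.1 i, neg_neg]
    rfl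
  rw [Finset.sum_congr rfl fun i _ => h2 i, Finset.sum_neg_distrib, ← inner_sum, ← divL_apply, h1,
    inner_zero_right, neg_zero]

theorem isClosed_V : IsClosed (V Ω : Set (Jet Ω)) := by
  have h : (V Ω : Set (Jet Ω)) = (H10 Ω : Set (Jet Ω)) ∩ {j | divL Ω j = 0} := by
    ext j
    exact and_congr_right fun _ => mem_divFree_iff
  rw [h]
  exact (Submodule.isClosed_topologicalClosure _).inter
    (isClosed_eq (divL Ω).continuous continuous_const)

/-- **Poincaré's inequality** in a bounded domain. -/
theorem exists_poincare (hΩ : Bornology.IsBounded Ω) (i : Fin d) :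
    ∃ C : ℝ, 0 < C ∧ ∀ w ∈ H10 Ω, ‖w.1‖ ≤ C * ‖w.2 i‖ := by
  obtain ⟨R, hR, hRΩ⟩ := hΩ.exists_pos_norm_le
  refine ⟨2 * R, by positivity, fun w hw => ?_⟩
  refine H10_induction (P := fun w => ‖w.1‖ ≤ 2 * R * ‖w.2 i‖) ?_ ?_ hw
  · exact isClosed_le continuous_fst.norm
      (continuous_const.mul ((continuous_apply i).comp continuous_snd).norm)
  intro j φ hφ h1 h2
  have hn : ∀ (f : L2 Ω) (χ : Rd d → Rd d), f =ᵐ[volume.restrict Ω] χ → (∀ x, x ∉ Ω → χ x = 0) →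
      ‖f‖ ^ 2 = ∫ x, ‖χ x‖ ^ 2 := by
    intro f χ hf hχ
    rw [← real_inner_self_eq_norm_sq, L2.inner_def,
      ← setIntegral_eq_integral_of_isTest (Ω := Ω) fun x hx => by simp [hχ x hx]]
    refine integral_congr_ae ?_
    filter_upwards [hf] with x hx
    rw [hx, real_inner_self_eq_norm_sq]
  have hn1 := hn _ _ h1 fun x hx => hφ.eq_zero hx
  have hn2 := hn _ _ (h2 i) fun x hx => hφ.fderiv_eq_zero (e i) hx
  have hc1 : Continuous fun x => ‖φ x‖ ^ 2 := hφ.contDiff.continuous.norm.pow 2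
  have hc2 : Continuous fun x => ‖fderiv ℝ φ x (e i)‖ ^ 2 :=
    (hφ.continuous_fderiv_apply (e i)).norm.pow 2
  have hs1 : HasCompactSupport fun x => ‖φ x‖ ^ 2 :=
    hφ.hasCompactSupport.comp_left (g := fun y => ‖y‖ ^ 2) (by simp)
  have hs2 : HasCompactSupport fun x => ‖fderiv ℝ φ x (e i)‖ ^ 2 :=
    (hφ.hasCompactSupport_fderiv_apply (e i)).comp_left (g := fun y => ‖y‖ ^ 2) (by simp)
  have hd : ∀ x, fderiv ℝ (fun x => ‖φ x‖ ^ 2) x (e i) =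
      2 * inner ℝ (φ x) (fderiv ℝ φ x (e i)) := by
    intro x
    rw [((hφ.differentiable x).hasFDerivAt.norm_sq).fderiv]
    simp
  have hdx : ∀ x : Rd d, HasFDerivAt (fun y : Rd d => y i)
      (EuclideanSpace.proj i : Rd d →L[ℝ] ℝ) x := fun x =>
    (EuclideanSpace.proj i : Rd d →L[ℝ] ℝ).hasFDerivAt
  have hdx1 : ∀ x : Rd d, fderiv ℝ (fun y : Rd d => y i) x (e i) = 1 := by
    intro x
    rw [(hdx x).fderiv]
    simp
  have hci : Continuous fun x : Rd d => x i := (EuclideanSpace.proj i : Rd d →L[ℝ] ℝ).continuous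
  have hcd : Continuous fun x => x i * fderiv ℝ (fun x => ‖φ x‖ ^ 2) x (e i) := by
    simp only [hd]
    exact hci.mul (continuous_const.mul
      (hφ.contDiff.continuous.inner (hφ.continuous_fderiv_apply (e i))))
  have hsd : HasCompactSupport fun x => x i * fderiv ℝ (fun x => ‖φ x‖ ^ 2) x (e i) :=
    (hs1.fderiv_apply (𝕜 := ℝ) (e i)).mul_left
  -- As `∂ᵢ xᵢ = 1`, one has `∫|φ|² = -∫ xᵢ ∂ᵢ|φ|²`. With `|xᵢ| ≤ R` on `Ω` and Young's inequality
  -- this is at most `½∫|φ|² + 2R²∫|∂ᵢφ|²`, hence the constant `2R`.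
  have hparts := integral_mul_fderiv_eq_neg_fderiv_mul_of_integrable (μ := volume)
    (f := fun x : Rd d => x i) (g := fun x => ‖φ x‖ ^ 2) (v := e i)
    (by simpa only [hdx1, one_mul] using hc1.integrable_of_hasCompactSupport hs1)
    (hcd.integrable_of_hasCompactSupport hsd)
    ((hci.mul hc1).integrable_of_hasCompactSupport hs1.mul_left)
    (fun x _ => (hdx x).differentiableAt)
    (fun x _ => ((hφ.differentiable x).hasFDerivAt.norm_sq).differentiableAt)
  simp only [hdx1, one_mul] at hparts
  have hle : -∫ x : Rd d, x i * fderiv ℝ (fun x => ‖φ x‖ ^ 2) x (e i) ≤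
      ∫ x, ((1 / 2) * ‖φ x‖ ^ 2 + 2 * R ^ 2 * ‖fderiv ℝ φ x (e i)‖ ^ 2) := by
    rw [← integral_neg]
    refine integral_mono (hcd.integrable_of_hasCompactSupport hsd).neg
      (((hc1.integrable_of_hasCompactSupport hs1).const_mul _).add
        ((hc2.integrable_of_hasCompactSupport hs2).const_mul _)) fun x => ?_
    simp only [hd]
    by_cases hx : x ∈ Ω
    · have h3 : |x i| ≤ R := (PiLp.norm_apply_le x i).trans (hRΩ x hx)
      have h4 := abs_real_inner_le_norm (φ x) (fderiv ℝ φ x (e i))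
      have h5 : -(x i * (2 * inner ℝ (φ x) (fderiv ℝ φ x (e i)))) ≤
          2 * (R * (‖φ x‖ * ‖fderiv ℝ φ x (e i)‖)) := by
        have h6 : |x i * inner ℝ (φ x) (fderiv ℝ φ x (e i))| ≤
            R * (‖φ x‖ * ‖fderiv ℝ φ x (e i)‖) := by
          rw [abs_mul]
          gcongr
        have := neg_abs_le (x i * inner ℝ (φ x) (fderiv ℝ φ x (e i)))
        linarith
      nlinarith [sq_nonneg (‖φ x‖ - 2 * (R * ‖fderiv ℝ φ x (e i)‖))]
    · simp only [hφ.eq_zero hx, hφ.fderiv_eq_zero _ hx]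
      simp
  rw [integral_add ((hc1.integrable_of_hasCompactSupport hs1).const_mul _)
    ((hc2.integrable_of_hasCompactSupport hs2).const_mul _), integral_const_mul,
    integral_const_mul, ← hn1, ← hn2] at hle
  rw [← hn1] at hparts
  refine (pow_le_pow_iff_left₀ (norm_nonneg _) (by positivity) two_ne_zero).1 ?_
  nlinarith

end WeakDerivatives

/-! ### The energy space, and weak solutions as mild solutions. -/

section Spaces

variable {d : ℕ} {Ω : Set (Rd d)}

/-- The gradient, as a map into a Hilbert space. -/
def gradL (Ω : Set (Rd d)) : V Ω →L[ℝ] PiLp 2 (fun _ : Fin d => L2 Ω) :=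
  ((PiLp.continuousLinearEquiv 2 ℝ (fun _ : Fin d => L2 Ω)).symm :
    (Fin d → L2 Ω) →L[ℝ] PiLp 2 (fun _ : Fin d => L2 Ω)).comp
    ((ContinuousLinearMap.snd ℝ _ _).comp (V Ω).subtypeL)

/-- The underlying field of an element of `V`, as a continuous linear map. -/
def fldL (Ω : Set (Rd d)) : V Ω →L[ℝ] L2 Ω :=
  (ContinuousLinearMap.fst ℝ _ _).comp (V Ω).subtypeL

theorem inner_gradL (u w : V Ω) : inner ℝ (gradL Ω u) (gradL Ω w) = gradInner u w := by
  rw [PiLp.inner_apply]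
  rfl

/-- `V` with the Hilbert norm `‖∇u‖`, realized as a space of gradients. -/
abbrev VE (Ω : Set (Rd d)) : Submodule ℝ (PiLp 2 (fun _ : Fin d => L2 Ω)) := (gradL Ω).range

/-- The closure of `V` in `L²`. -/
abbrev H0 (Ω : Set (Rd d)) : Submodule ℝ (L2 Ω) := (fldL Ω).range.topologicalClosure

theorem fld_mem_H0 (u : V Ω) : fld u ∈ H0 Ω :=
  Submodule.le_topologicalClosure _ ⟨u, rfl⟩

theorem exists_norm_le_gradL (hΩ : Bornology.IsBounded Ω) (i : Fin d) :
    ∃ C : ℝ, ∀ u : V Ω, ‖u‖ ≤ C * ‖gradL Ω u‖ := by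
  obtain ⟨C, hC, h⟩ := exists_poincare hΩ i
  refine ⟨C + 1, fun u => ?_⟩
  have hpd : ∀ j, ‖(u : Jet Ω).2 j‖ ≤ ‖gradL Ω u‖ := fun j => PiLp.norm_apply_le (gradL Ω u) j
  have h0 : 0 ≤ ‖gradL Ω u‖ := norm_nonneg _
  change max ‖(u : Jet Ω).1‖ ‖(u : Jet Ω).2‖ ≤ _
  refine max_le ?_ ((pi_norm_le_iff_of_nonneg (by positivity)).2 fun j => ?_)
  · have h1 := h u u.2.1
    have h2 : C * ‖(u : Jet Ω).2 i‖ ≤ C * ‖gradL Ω u‖ := by gcongr; exact hpd i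
    linarith
  · have h1 := hpd j
    nlinarith

/-- By Poincaré the gradient is bounded below on the complete space `V`, so it is an isomorphism
onto a closed subspace. This replaces the non-Hilbertian product norm of `Jet` by a Hilbert one. -/
theorem exists_equiv_VE (hΩ : Bornology.IsBounded Ω) (i : Fin d) :
    IsClosed (VE Ω : Set (PiLp 2 (fun _ : Fin d => L2 Ω))) ∧
    ∃ Φ : V Ω ≃L[ℝ] VE Ω, ∀ u, (Φ u : PiLp 2 (fun _ : Fin d => L2 Ω)) = gradL Ω u := by
  obtain ⟨C, hC⟩ := exists_norm_le_gradL hΩ i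
  have : CompleteSpace (V Ω) := isClosed_V.completeSpace_coe
  have hanti : AntilipschitzWith C.toNNReal (gradL Ω) :=
    (gradL Ω).antilipschitz_of_bound fun u => (hC u).trans (by
      gcongr
      exact Real.le_coe_toNNReal C)
  have hcl := hanti.isClosed_range (gradL Ω).uniformContinuous
  exact ⟨hcl, (gradL Ω).equivRange hanti.injective hcl, fun u => rfl⟩

/-- Multiplication by a bounded function. -/
def mulL {a : Rd d → ℝ} (ha : MemLp a ∞ (volume.restrict Ω)) : L2 Ω →L[ℝ] L2 Ω :=
  (ContinuousLinearMap.lsmul ℝ ℝ).holderL (volume.restrict Ω) ∞ 2 2 (ha.toLp a)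

theorem coeFn_mulL {a : Rd d → ℝ} (ha : MemLp a ∞ (volume.restrict Ω)) (f : L2 Ω) :
    (mulL ha f : Rd d → Rd d) =ᵐ[volume.restrict Ω] fun x => a x • f x := by
  have h := (ContinuousLinearMap.lsmul ℝ ℝ).coeFn_holder (r := 2) (ha.toLp a) f
  filter_upwards [h, ha.coeFn_toLp] with x h1 h2
  refine h1.trans ?_
  rw [h2]
  rfl

theorem inner_mulL {a : Rd d → ℝ} (ha : MemLp a ∞ (volume.restrict Ω)) (f g : L2 Ω) :
    inner ℝ (mulL ha f) g = ∫ x in Ω, a x * inner ℝ (f x) (g x) := by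
  rw [L2.inner_def]
  refine integral_congr_ae ?_
  filter_upwards [coeFn_mulL ha f] with x hx
  rw [hx, real_inner_smul_left]

/-- The compression of the multiplication by `a` to `H0`. -/
def damp {a : Rd d → ℝ} (ha : MemLp a ∞ (volume.restrict Ω)) : H0 Ω →L[ℝ] H0 Ω :=
  (ContinuousLinearMap.adjoint (H0 Ω).subtypeL).comp ((mulL ha).comp (H0 Ω).subtypeL)

theorem inner_damp {a : Rd d → ℝ} (ha : MemLp a ∞ (volume.restrict Ω)) (f g : H0 Ω) :
    inner ℝ (damp ha f) g = inner ℝ (mulL ha (f : L2 Ω)) (g : L2 Ω) := by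
  simp only [damp, ContinuousLinearMap.comp_apply, ContinuousLinearMap.adjoint_inner_left]
  rfl

theorem inner_damp_comm {a : Rd d → ℝ} (ha : MemLp a ∞ (volume.restrict Ω)) (f g : H0 Ω) :
    inner ℝ (damp ha f) g = inner ℝ f (damp ha g) := by
  rw [← real_inner_comm f, inner_damp, inner_damp, inner_mulL, inner_mulL]
  simp only [real_inner_comm]

theorem inner_damp_nonneg {a : Rd d → ℝ} (ha : MemLp a ∞ (volume.restrict Ω))
    (ha0 : ∀ᵐ x ∂(volume.restrict Ω), 0 ≤ a x) (f : H0 Ω) : 0 ≤ inner ℝ (damp ha f) f := by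
  rw [inner_damp, inner_mulL]
  refine integral_nonneg_of_ae ?_
  filter_upwards [ha0] with x hx
  exact mul_nonneg hx real_inner_self_nonneg

/-- Makes the undamped system the case `a = 0` of the damped one. -/
theorem damp_zero (h0 : MemLp (fun _ : Rd d => (0 : ℝ)) ∞ (volume.restrict Ω)) :
    damp h0 = 0 := by
  ext1 f
  refine ext_inner_right ℝ fun g => ?_
  rw [inner_damp, inner_mulL]
  simp

variable (Φ : V Ω ≃L[ℝ] VE Ω)

/-- The embedding of `V` into `H0`, in the Hilbert space model of `V`. -/
def embed : VE Ω →L[ℝ] H0 Ω :=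
  ((fldL Ω).codRestrict (H0 Ω) fld_mem_H0).comp (Φ.symm : VE Ω →L[ℝ] V Ω)

theorem coe_embed (f : VE Ω) : (embed Φ f : L2 Ω) = fld (Φ.symm f) := rfl

theorem coe_embed_apply (u : V Ω) : (embed Φ (Φ u) : L2 Ω) = fld u := by
  rw [coe_embed, Φ.symm_apply_apply]

/-- A jet in `V` is determined by its field, because its derivative components are weak derivatives,
and these are unique. -/
theorem injective_embed (hΩ : IsOpen Ω) : Function.Injective (embed Φ) := by
  rw [injective_iff_map_eq_zero]
  intro f hf
  set u := Φ.symm f with hu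
  have h1 : fld u = 0 := by
    rw [hu, ← coe_embed, hf]
    rfl
  have h2 : u = 0 := by
    refine Subtype.ext (Prod.ext h1 (funext fun i => ?_))
    refine (hasWeakPartial_of_mem_H10 u.2.1 i).unique hΩ ?_
    have h3 : (u : Jet Ω).1 = 0 := h1
    rw [h3]
    exact hasWeakPartial_of_mem_H10 (H10 Ω).zero_mem i
  rwa [hu, map_eq_zero_iff _ Φ.symm.injective] at h2

theorem denseRange_embed : DenseRange (embed Φ) := by
  intro f
  rw [closure_subtype]
  refine closure_mono ?_ (show (f : L2 Ω) ∈ closure ((fldL Ω).range : Set (L2 Ω)) from f.2)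
  rintro _ ⟨u, rfl⟩
  exact ⟨embed Φ (Φ u), ⟨Φ u, rfl⟩, coe_embed_apply Φ u⟩

/-- The energy space. -/
abbrev State (Ω : Set (Rd d)) : Type := WithLp 2 (VE Ω × H0 Ω)

/-- `X = (u, ∂ₜ u)`. -/
def Represents (u : ℝ → V Ω) (X : ℝ → State Ω) : Prop :=
  ∀ t, (X t).fst = Φ (u t) ∧ ((X t).snd : L2 Ω) = velocity u t

/-- Difference quotients lie in the image of `V`, so their limits lie in its closure. The velocity
is therefore automatically in `H0`, and density of `V` in `H` is never needed, however rough the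
boundary. -/
theorem velocity_mem_H0 (u : ℝ → V Ω) (t : ℝ) : velocity u t ∈ H0 Ω := by
  have h := range_deriv_subset_closure_span_image (𝕜 := ℝ) (fun s => fld (u s)) dense_univ
    ⟨t, rfl⟩
  refine closure_mono ?_ h
  refine (Submodule.span_le (p := (fldL Ω).range)).2 ?_
  rintro _ ⟨s, -, rfl⟩
  exact ⟨u s, rfl⟩

theorem exists_represents (u : ℝ → V Ω) : ∃ X, Represents Φ u X :=
  ⟨fun t => WithLp.toLp 2 (Φ (u t), ⟨velocity u t, velocity_mem_H0 u t⟩), fun _ => ⟨rfl, rfl⟩⟩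

variable {Φ} in
theorem Represents.energy_eq (hΦ : ∀ u, (Φ u : PiLp 2 (fun _ : Fin d => L2 Ω)) = gradL Ω u)
    {u : ℝ → V Ω} {X : ℝ → State Ω} (h : Represents Φ u X) (t : ℝ) :
    energy u t = (1 / 2) * ‖X t‖ ^ 2 := by
  have hn : ∀ f : L2 Ω, ∫ x in Ω, ‖f x‖ ^ 2 = ‖f‖ ^ 2 := by
    intro f
    rw [← real_inner_self_eq_norm_sq, L2.inner_def]
    simp only [real_inner_self_eq_norm_sq]
  have hi : ∀ f : L2 Ω, Integrable (fun x => ‖f x‖ ^ 2) (volume.restrict Ω) := by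
    intro f
    simpa only [real_inner_self_eq_norm_sq] using L2.integrable_inner (𝕜 := ℝ) f f
  have h1 : ‖X t‖ ^ 2 = ‖velocity u t‖ ^ 2 + ∑ i, ‖pd (u t) i‖ ^ 2 := by
    rw [← real_inner_self_eq_norm_sq, WithLp.prod_inner_apply]
    change inner ℝ (X t).fst (X t).fst + inner ℝ (X t).snd (X t).snd = _
    rw [Submodule.coe_inner, Submodule.coe_inner, (h t).1, (h t).2, hΦ, inner_gradL, gradInner]
    simp only [real_inner_self_eq_norm_sq]
    ring
  rw [h1, energy, integral_add (hi _) (integrable_finsetSum _ fun i _ => hi _),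
    integral_finsetSum _ fun i _ => hi _, hn]
  simp only [hn]

variable {Φ} in
theorem Represents.dissipation_eq {a : Rd d → ℝ} (ha : MemLp a ∞ (volume.restrict Ω))
    {u : ℝ → V Ω} {X : ℝ → State Ω} (h : Represents Φ u X) (T : ℝ) :
    dissipation a u T = ∫ t in (0 : ℝ)..T, inner ℝ (dampOp (VE Ω) (damp ha) (X t)) (X t) := by
  refine intervalIntegral.integral_congr fun t _ => ?_
  simp only [inner_dampOp]
  rw [inner_damp, inner_mulL, (h t).2]
  simp only [real_inner_self_eq_norm_sq]

/-- The trajectories in the energy space of a class of solutions. -/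
def trajectories (IsSol : (ℝ → V Ω) → Prop) : Set (ℝ → State Ω) :=
  {X | ∃ u, IsSol u ∧ Represents Φ u X}

variable {Φ} in
theorem stabilization_iff (hΦ : ∀ u, (Φ u : PiLp 2 (fun _ : Fin d => L2 Ω)) = gradL Ω u)
    (IsSol : (ℝ → V Ω) → Prop) : Stabilization IsSol ↔
      ∃ C₀ > (0 : ℝ), ∃ α > (0 : ℝ), ∀ X ∈ trajectories Φ IsSol, ∀ t : ℝ, 0 ≤ t →
        ‖X t‖ ^ 2 ≤ C₀ * ‖X 0‖ ^ 2 * Real.exp (-α * t) := by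
  refine exists_congr fun C₀ => and_congr_right fun _ => exists_congr fun α =>
    and_congr_right fun _ => ⟨?_, ?_⟩
  · rintro h X ⟨u, hu, hX⟩ t ht
    have h1 := h u hu t ht
    rw [hX.energy_eq hΦ, hX.energy_eq hΦ] at h1
    linarith
  · intro h u hu t ht
    obtain ⟨X, hX⟩ := exists_represents Φ u
    have h1 := h X ⟨u, hu, hX⟩ t ht
    rw [hX.energy_eq hΦ, hX.energy_eq hΦ]
    linarith

variable {Φ} in
theorem observability_iff (hΦ : ∀ u, (Φ u : PiLp 2 (fun _ : Fin d => L2 Ω)) = gradL Ω u)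
    {a : Rd d → ℝ} (ha : MemLp a ∞ (volume.restrict Ω)) (IsSol : (ℝ → V Ω) → Prop) :
    Observability a IsSol ↔ ∃ C > (0 : ℝ), ∃ T > (0 : ℝ), ∀ Y ∈ trajectories Φ IsSol,
      ‖Y 0‖ ^ 2 ≤ C * ∫ t in (0 : ℝ)..T, inner ℝ (dampOp (VE Ω) (damp ha) (Y t)) (Y t) := by
  constructor
  · rintro ⟨C, hC, T, hT, h⟩
    refine ⟨2 * C, by positivity, T, hT, ?_⟩
    rintro Y ⟨u, hu, hY⟩
    have h1 := h u hu
    rw [hY.energy_eq hΦ, hY.dissipation_eq ha] at h1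
    linarith
  · rintro ⟨C, hC, T, hT, h⟩
    refine ⟨C / 2, by positivity, T, hT, fun u hu => ?_⟩
    obtain ⟨Y, hY⟩ := exists_represents Φ u
    have h1 := h Y ⟨u, hu, hY⟩
    rw [hY.energy_eq hΦ, hY.dissipation_eq ha]
    linarith

/-- Orthogonality to gradients is a closed condition that holds on `V`; so the requirement on the
velocity in `IsWeakSolution` comes for free. -/
theorem memH_of_mem_H0 {f : L2 Ω} (hf : f ∈ H0 Ω) : MemH Ω f := by
  intro p G hG
  have h : (H0 Ω : Set (L2 Ω)) ⊆ {f | inner ℝ f G = 0} := by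
    refine closure_minimal ?_ (isClosed_eq (continuous_id.inner continuous_const) continuous_const)
    rintro _ ⟨u, rfl⟩
    exact inner_gradient_eq_zero hG u
  exact h hf

variable {Φ} in
theorem inner_Phi (hΦ : ∀ u, (Φ u : PiLp 2 (fun _ : Fin d => L2 Ω)) = gradL Ω u) (u w : V Ω) :
    inner ℝ (Φ u) (Φ w) = gradInner u w := by
  rw [Submodule.coe_inner, hΦ, hΦ, inner_gradL]

variable [CompleteSpace (VE Ω)]

variable {Φ} in
theorem IsWeakSolution.isMild (hΦ : ∀ u, (Φ u : PiLp 2 (fun _ : Fin d => L2 Ω)) = gradL Ω u)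
    {a : Rd d → ℝ} (ha : MemLp a ∞ (volume.restrict Ω)) {u : ℝ → V Ω} (hu : IsWeakSolution a u)
    {X : ℝ → State Ω} (hX : Represents Φ u X) :
    IsMild (waveOp (embed Φ)) (fun t => -dampOp (VE Ω) (damp ha) (X t)) X := by
  obtain ⟨hc, hd, -, hw⟩ := hu
  have hvel : Continuous (velocity u) := hd.continuous_deriv le_rfl
  have h1 : ∀ t, HasDerivAt (fun s => fld (u s)) (velocity u t) t := fun t =>
    ((hd.differentiable one_ne_zero) t).hasDerivAt
  refine isMild_waveOp_iff.2 ⟨continuous_withLp_prod_iff.2 ⟨?_, ?_⟩, fun t => ?_, fun w t => ?_⟩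
  · simp only [(hX _).1]
    exact Φ.continuous.comp hc
  · refine Continuous.congr (hvel.subtype_mk (velocity_mem_H0 u)) fun t => ?_
    exact Subtype.ext (hX t).2.symm
  -- The derivative is known in `L²`; testing against `H0` transfers it to the subspace `H0`.
  · refine (hasDerivAt_of_forall_inner (f' := fun t => (X t).snd) ?_ (fun g t => ?_) t)
    · refine Continuous.congr (hvel.subtype_mk (velocity_mem_H0 u)) fun t => ?_
      exact Subtype.ext (hX t).2.symm
    · simp only [Submodule.coe_inner, (hX _).1, (hX _).2, coe_embed_apply]
      simpa using (h1 t).inner ℝ (hasDerivAt_const t (g : L2 Ω))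
  · obtain ⟨w, rfl⟩ := Φ.surjective w
    have h2 := hw w t
    rw [← inner_mulL ha] at h2
    simp only [inner_damp]
    simp only [Submodule.coe_inner (W := H0 Ω), (hX _).2, coe_embed_apply, (hX _).1,
      inner_Phi hΦ]
    exact h2

variable {Φ} in
theorem IsMild.represents {a : Rd d → ℝ} (ha : MemLp a ∞ (volume.restrict Ω)) {X : ℝ → State Ω}
    (hX : IsMild (waveOp (embed Φ)) (fun t => -dampOp (VE Ω) (damp ha) (X t)) X) :
    (∀ t, HasDerivAt (fun s => fld (Φ.symm (X s).fst)) ((X t).snd : L2 Ω) t) ∧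
    Represents Φ (fun t => Φ.symm (X t).fst) X := by
  obtain ⟨-, h1, -⟩ := isMild_waveOp_iff.1 hX
  have h2 : ∀ t, HasDerivAt (fun s => fld (Φ.symm (X s).fst)) ((X t).snd : L2 Ω) t := fun t =>
    (H0 Ω).subtypeL.hasFDerivAt.comp_hasDerivAt t (h1 t)
  exact ⟨h2, fun t => ⟨(Φ.apply_symm_apply _).symm, (h2 t).deriv.symm⟩⟩

variable {Φ} in
theorem IsMild.isWeakSolution
    (hΦ : ∀ u, (Φ u : PiLp 2 (fun _ : Fin d => L2 Ω)) = gradL Ω u)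
    {a : Rd d → ℝ} (ha : MemLp a ∞ (volume.restrict Ω)) {X : ℝ → State Ω}
    (hX : IsMild (waveOp (embed Φ)) (fun t => -dampOp (VE Ω) (damp ha) (X t)) X) :
    IsWeakSolution a (fun t => Φ.symm (X t).fst) := by
  obtain ⟨h1, hrep⟩ := hX.represents ha
  obtain ⟨hc, -, h2⟩ := isMild_waveOp_iff.1 hX
  have hc' := continuous_withLp_prod_iff.1 hc
  refine ⟨Φ.symm.continuous.comp hc'.1, ?_, fun t => memH_of_mem_H0 (velocity_mem_H0 _ t),
    fun w t => ?_⟩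
  · rw [contDiff_one_iff_deriv]
    refine ⟨fun t => (h1 t).differentiableAt, ?_⟩
    rw [funext fun t => (h1 t).deriv]
    exact continuous_subtype_val.comp hc'.2
  · have h3 := h2 (Φ w) t
    simp only [inner_damp] at h3
    generalize (fun t => Φ.symm (X t).fst) = u at hrep ⊢
    simp only [Submodule.coe_inner (W := H0 Ω), (hrep _).2, coe_embed_apply, (hrep _).1,
      inner_Phi hΦ] at h3
    rw [← inner_mulL ha]
    exact h3

end Spaces

/-! ### Strong solutions and Stokes regularity. -/

section Strong

variable {d : ℕ} {Ω : Set (Rd d)}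

theorem gradInner_eq_of_hasHessian {u : V Ω} {S : Fin d → Fin d → L2 Ω} (hS : HasHessian u S)
    (w : V Ω) : gradInner u w = -inner ℝ (∑ i, S i i) (fld w) := by
  rw [sum_inner, ← Finset.sum_neg_distrib]
  exact Finset.sum_congr rfl fun i _ => inner_eq_neg_inner (hS i i) w.2.1

/-- A strong solution satisfies the variational equation at each time. -/
theorem IsStrongSolution.exists_acc {a : Rd d → ℝ} (ha : MemLp a ∞ (volume.restrict Ω))
    {u : ℝ → V Ω} (hu : IsStrongSolution a u) (t : ℝ) :
    ∃ acc, HasDerivAt (velocity u) acc t ∧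
      ∀ w, gradInner (u t) w = -inner ℝ (acc + mulL ha (velocity u t)) (fld w) := by
  obtain ⟨-, S, -, hS, h⟩ := hu
  obtain ⟨acc, p, G, hacc, hG, heq⟩ := h t
  refine ⟨acc, hacc, fun w => ?_⟩
  have h1 : ∑ i, S t i i = acc + mulL ha (velocity u t) + G := by
    refine Lp.ext ?_
    filter_upwards [heq, Lp.coeFn_finsetSum Finset.univ fun i => S t i i,
      Lp.coeFn_add (acc + mulL ha (velocity u t)) G, Lp.coeFn_add acc (mulL ha (velocity u t)),
      coeFn_mulL ha (velocity u t)] with x h1 h2 h3 h4 h5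
    rw [h2, h3, Pi.add_apply, h4, Pi.add_apply, h5, Finset.sum_apply, ← sub_eq_zero, ← neg_eq_zero,
      ← h1]
    abel
  rw [gradInner_eq_of_hasHessian (hS t), h1, inner_add_left _ G, real_inner_comm _ G,
    inner_gradient_eq_zero hG, add_zero]

/-- The pressure gradient disappears against `V`. Strong solutions are thereby mild solutions, to
which the abstract equivalence applies. -/
theorem IsStrongSolution.isWeakSolution {a : Rd d → ℝ} (ha : MemLp a ∞ (volume.restrict Ω))
    {u : ℝ → V Ω} (hu : IsStrongSolution a u) : IsWeakSolution a u := by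
  refine ⟨hu.1.continuous, (fldL Ω).contDiff.comp hu.1,
    fun t => memH_of_mem_H0 (velocity_mem_H0 u t), fun w t => ?_⟩
  obtain ⟨acc, hacc, h⟩ := hu.exists_acc ha t
  rw [h w, ← inner_mulL ha, inner_add_left, neg_neg, add_sub_cancel_right]
  simpa using hacc.inner ℝ (hasDerivAt_const t (fld w))

theorem HasHessian.unique (hΩ : IsOpen Ω) {u : V Ω} {S S' : Fin d → Fin d → L2 Ω}
    (h : HasHessian u S) (h' : HasHessian u S') : S = S' :=
  funext fun i => funext fun j => (h i j).unique hΩ (h' i j)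

theorem HasHessian.add {u v : V Ω} {S S' : Fin d → Fin d → L2 Ω}
    (h : HasHessian u S) (h' : HasHessian v S') : HasHessian (u + v) (S + S') := by
  intro i j
  refine hasWeakPartial_iff (f := pd u i + pd v i) (g := S i j + S' i j) |>.2 fun ψ hψ => ?_
  rw [map_add, map_add, hasWeakPartial_iff.1 (h i j) ψ hψ, hasWeakPartial_iff.1 (h' i j) ψ hψ,
    neg_add]

theorem HasHessian.smul (c : ℝ) {u : V Ω} {S : Fin d → Fin d → L2 Ω}
    (h : HasHessian u S) : HasHessian (c • u) (c • S) := by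
  intro i j
  refine hasWeakPartial_iff (f := c • pd u i) (g := c • S i j) |>.2 fun ψ hψ => ?_
  rw [map_smul, map_smul, hasWeakPartial_iff.1 (h i j) ψ hψ, smul_neg]

theorem isClosed_hasHessian :
    IsClosed {q : V Ω × (Fin d → Fin d → L2 Ω) | HasHessian q.1 q.2} := by
  have h : {q : V Ω × (Fin d → Fin d → L2 Ω) | HasHessian q.1 q.2} = ⋂ i, ⋂ j,
      (fun q : V Ω × (Fin d → Fin d → L2 Ω) => (pd q.1 i, q.2 i j)) ⁻¹'
        {q | HasWeakPartial Ω j (fun x => q.1 x) (fun x => q.2 x)} := by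
    ext q
    simp [HasHessian]
  rw [h]
  refine isClosed_iInter fun i => isClosed_iInter fun j => (isClosed_hasWeakPartial j).preimage ?_
  have h1 : Continuous fun q : V Ω × (Fin d → Fin d → L2 Ω) => pd q.1 i :=
    ((continuous_apply i).comp continuous_snd).comp (continuous_subtype_val.comp continuous_fst)
  have h2 : Continuous fun q : V Ω × (Fin d → Fin d → L2 Ω) => q.2 i j :=
    (continuous_apply j).comp ((continuous_apply i).comp continuous_snd)
  exact h1.prodMk h2

variable (Φ : V Ω ≃L[ℝ] VE Ω) [CompleteSpace (VE Ω)]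

/-- The solution operator of the Stokes problem. -/
def stokesSol : L2 Ω →L[ℝ] V Ω :=
  (Φ.symm : VE Ω →L[ℝ] V Ω).comp ((ContinuousLinearMap.adjoint (embed Φ)).comp
    (ContinuousLinearMap.adjoint (H0 Ω).subtypeL))

variable {Φ}

theorem inner_adjoint_embed (f : L2 Ω) (w : V Ω) :
    inner ℝ (ContinuousLinearMap.adjoint (embed Φ)
      (ContinuousLinearMap.adjoint (H0 Ω).subtypeL f)) (Φ w) = inner ℝ f (fld w) := by
  rw [ContinuousLinearMap.adjoint_inner_left, ContinuousLinearMap.adjoint_inner_left]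
  change inner ℝ f (embed Φ (Φ w) : L2 Ω) = _
  rw [coe_embed_apply]

/-- Riesz representation: the variational Stokes problem is solved by `J*` applied to the projection
of `f` onto `H0`. -/
theorem Phi_eq_adjoint_embed
    (hΦ : ∀ u, (Φ u : PiLp 2 (fun _ : Fin d => L2 Ω)) = gradL Ω u) {u : V Ω} {f : L2 Ω}
    (h : ∀ w, gradInner u w = inner ℝ f (fld w)) :
    Φ u = ContinuousLinearMap.adjoint (embed Φ)
      (ContinuousLinearMap.adjoint (H0 Ω).subtypeL f) := by
  refine ext_inner_right ℝ fun w => ?_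
  obtain ⟨w, rfl⟩ := Φ.surjective w
  rw [inner_adjoint_embed, inner_Phi hΦ, h]

theorem gradInner_stokesSol (hΦ : ∀ u, (Φ u : PiLp 2 (fun _ : Fin d => L2 Ω)) = gradL Ω u)
    (f : L2 Ω) (w : V Ω) : gradInner (stokesSol Φ f) w = inner ℝ f (fld w) := by
  rw [← inner_Phi hΦ, ← inner_adjoint_embed (Φ := Φ)]
  simp [stokesSol]

/-- On a regular domain, the Hessian of the solution of the Stokes problem depends continuously
on the data. -/
theorem StokesRegular.exists_continuous_hessian (hreg : StokesRegular Ω) (hΩ : IsOpen Ω)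
    (hΦ : ∀ u, (Φ u : PiLp 2 (fun _ : Fin d => L2 Ω)) = gradL Ω u) :
    ∃ S : L2 Ω → Fin d → Fin d → L2 Ω, Continuous S ∧ ∀ f, HasHessian (stokesSol Φ f) (S f) ∧
      ∃ (p : L2s Ω) (G : L2 Ω), HasWeakGradient Ω p G ∧
        ∀ᵐ x ∂(volume.restrict Ω), - (∑ i : Fin d, S f i i x) + G x = f x := by
  choose S p G hS hG heq using fun f => hreg (stokesSol Φ f) f (gradInner_stokesSol hΦ f)
  let L : L2 Ω →ₗ[ℝ] Fin d → Fin d → L2 Ω :=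
    { toFun := S
      map_add' := fun f g => (hS (f + g)).unique hΩ (by
        rw [map_add]; exact (hS f).add (hS g))
      map_smul' := fun c f => (hS (c • f)).unique hΩ (by
        rw [map_smul]; exact (hS f).smul c) }
  have hL : Continuous L := by
    -- `StokesRegular` asserts existence without any estimate. Uniqueness of the Hessian makes it
    -- linear in `f`, and its graph is the preimage of a closed relation under the continuous
    -- solution operator, so the closed graph theorem supplies the bound.
    refine L.continuous_of_isClosed_graph ?_
    have h : (L.graph : Set (L2 Ω × (Fin d → Fin d → L2 Ω))) =
        (fun q : L2 Ω × (Fin d → Fin d → L2 Ω) => (stokesSol Φ q.1, q.2)) ⁻¹'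
          {q | HasHessian q.1 q.2} := by
      ext ⟨f, S'⟩
      constructor
      · intro h
        have h1 : S' = S f := (LinearMap.mem_graph_iff _ _).1 h
        rw [h1]
        exact hS f
      · intro h
        exact (LinearMap.mem_graph_iff _ _).2 (HasHessian.unique hΩ h (hS f))
    rw [h]
    exact isClosed_hasHessian.preimage
      (((stokesSol Φ).continuous.comp continuous_fst).prodMk continuous_snd)
  exact ⟨S, hL, fun f => ⟨hS f, p f, G f, hG f, heq f⟩⟩

/-- At each time `u t` solves the Stokes problem with right-hand side `-(acc t + a ∂ₜu)`, which is
continuous in time with values in `L²`; the continuity of the Hessian follows. -/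
theorem StokesRegular.isStrongSolution (hreg : StokesRegular Ω) (hΩ : IsOpen Ω)
    (hΦ : ∀ u, (Φ u : PiLp 2 (fun _ : Fin d => L2 Ω)) = gradL Ω u)
    {a : Rd d → ℝ} (ha : MemLp a ∞ (volume.restrict Ω)) {u : ℝ → V Ω} (hu : ContDiff ℝ 1 u)
    {acc : ℝ → L2 Ω} (hacc : ∀ t, HasDerivAt (velocity u) (acc t) t) (hc : Continuous acc)
    (h : ∀ t w, gradInner (u t) w = -inner ℝ (acc t + mulL ha (velocity u t)) (fld w)) :
    IsStrongSolution a u := by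
  obtain ⟨S, hSc, hS⟩ := hreg.exists_continuous_hessian hΩ hΦ
  have hv : Continuous (velocity u) := continuous_iff_continuousAt.2 fun t => (hacc t).continuousAt
  set f : ℝ → L2 Ω := fun t => -(acc t + mulL ha (velocity u t)) with hf
  have hfc : Continuous f := (hc.add ((mulL ha).continuous.comp hv)).neg
  have hst : ∀ t, stokesSol Φ (f t) = u t := by
    intro t
    rw [stokesSol, ContinuousLinearMap.comp_apply, ContinuousLinearMap.comp_apply,
      ← Phi_eq_adjoint_embed hΦ (u := u t) fun w => by rw [h, hf, inner_neg_left]]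
    exact Φ.symm_apply_apply (u t)
  refine ⟨hu, fun t => S (f t), hSc.comp hfc, fun t => by rw [← hst]; exact (hS (f t)).1,
    fun t => ?_⟩
  obtain ⟨p, G, hG, heq⟩ := (hS (f t)).2
  refine ⟨acc t, p, G, hacc t, hG, ?_⟩
  filter_upwards [heq, Lp.coeFn_neg (acc t + mulL ha (velocity u t)),
    Lp.coeFn_add (acc t) (mulL ha (velocity u t)), coeFn_mulL ha (velocity u t)] with x h1 h2 h3 h4
  have h5 : f t x = -(acc t x + a x • velocity u t x) := by
    rw [hf, h2, Pi.neg_apply, h3, Pi.add_apply, h4]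
  rw [h5] at h1
  have h6 := eq_neg_iff_add_eq_zero.1 h1
  rw [← h6]
  abel

/-- Existence of strong solutions with regular data. -/
theorem StokesRegular.exists_isStrongSolution_of_data (hreg : StokesRegular Ω) (hΩ : IsOpen Ω)
    (hΦ : ∀ u, (Φ u : PiLp 2 (fun _ : Fin d => L2 Ω)) = gradL Ω u)
    {a : Rd d → ℝ} (ha : MemLp a ∞ (volume.restrict Ω)) (f₀ : VE Ω) (h₀ : H0 Ω) :
    ∃ Y ∈ trajectories Φ (IsStrongSolution a),
      Y 0 = WithLp.toLp 2 (ContinuousLinearMap.adjoint (embed Φ) h₀, embed Φ f₀) := by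
  obtain ⟨Y, Z, hY0, hY, hZc, hYZ, -, hYf⟩ := exists_isMild_waveOp_regular
    (injective_embed Φ hΩ) (denseRange_embed Φ) (damp ha) f₀ h₀
  obtain ⟨-, hrep⟩ := hY.represents ha
  have hZ := continuous_withLp_prod_iff.1 hZc
  have hd : ∀ t, HasDerivAt (fun t => Φ.symm (Y t).fst) (Φ.symm (Z t).fst) t := fun t =>
    (Φ.symm : VE Ω →L[ℝ] V Ω).hasFDerivAt.comp_hasDerivAt t
      (hasDerivAt_withLp_prod_iff.1 (hYZ t)).1
  have hu : ContDiff ℝ 1 (fun t => Φ.symm (Y t).fst) := by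
    rw [contDiff_one_iff_deriv]
    refine ⟨fun t => (hd t).differentiableAt, ?_⟩
    rw [funext fun t => (hd t).deriv]
    exact Φ.symm.continuous.comp hZ.1
  refine ⟨Y, ⟨_, ?_, hrep⟩, hY0⟩
  generalize (fun t => Φ.symm (Y t).fst) = u at hu hrep
  have hvel : velocity u = fun t => ((Y t).snd : L2 Ω) := funext fun t => (hrep t).2.symm
  refine hreg.isStrongSolution hΩ hΦ ha hu (acc := fun t => ((Z t).snd : L2 Ω)) (fun t => ?_)
    (continuous_subtype_val.comp hZ.2) fun t w => ?_
  · rw [hvel]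
    exact (H0 Ω).subtypeL.hasFDerivAt.comp_hasDerivAt t
      (hasDerivAt_withLp_prod_iff.1 (hYZ t)).2
  · have h := hYf t (Φ w)
    rw [(hrep t).1, inner_Phi hΦ, inner_add_left, inner_damp, Submodule.coe_inner,
      coe_embed_apply, (hrep t).2] at h
    rw [h, inner_add_left]

/-- Existence of strong solutions, with the same data as a strong solution for another damping. -/
theorem StokesRegular.exists_isStrongSolution (hreg : StokesRegular Ω) (hΩ : IsOpen Ω)
    (hΦ : ∀ u, (Φ u : PiLp 2 (fun _ : Fin d => L2 Ω)) = gradL Ω u)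
    {a a' : Rd d → ℝ} (ha : MemLp a ∞ (volume.restrict Ω))
    (ha' : MemLp a' ∞ (volume.restrict Ω)) {X : ℝ → State Ω}
    (hX : X ∈ trajectories Φ (IsStrongSolution a)) (τ : ℝ) :
    ∃ Y ∈ trajectories Φ (IsStrongSolution a'), Y 0 = X τ := by
  obtain ⟨u, hu, hrep⟩ := hX
  obtain ⟨acc, -, hacc⟩ := hu.exists_acc ha τ
  -- A state of a strong solution lies in the domain of `A`: the velocity comes from `deriv u τ` in
  -- `V`, and `u τ` solves a Stokes problem with `L²` data. The damping `a` enters only that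
  -- right-hand side, so the same state is admissible for `a'`.
  obtain ⟨Y, hY, hY0⟩ := hreg.exists_isStrongSolution_of_data hΩ hΦ ha' (Φ (deriv u τ))
    (ContinuousLinearMap.adjoint (H0 Ω).subtypeL (-(acc + mulL ha (velocity u τ))))
  refine ⟨Y, hY, ?_⟩
  rw [hY0, ← Phi_eq_adjoint_embed hΦ (u := u τ) (fun w => by rw [hacc, inner_neg_left])]
  refine WithLp.ofLp_injective 2 (Prod.ext (hrep τ).1.symm (Subtype.ext ?_))
  change (embed Φ (Φ (deriv u τ)) : L2 Ω) = ((X τ).snd : L2 Ω)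
  rw [coe_embed_apply, (hrep τ).2, velocity]
  exact ((fldL Ω).hasFDerivAt.comp_hasDerivAt τ
    ((hu.1.differentiable one_ne_zero) τ).hasDerivAt).deriv.symm

/-- Stabilization and observability are equivalent for classes of weak solutions with the same
initial data. -/
theorem stabilization_iff_observability_of_trajectories
    (hΩ : IsOpen Ω) (hΦ : ∀ u, (Φ u : PiLp 2 (fun _ : Fin d => L2 Ω)) = gradL Ω u)
    {a : Rd d → ℝ} (ha : MemLp a ∞ (volume.restrict Ω))
    (ha0 : ∀ᵐ x ∂(volume.restrict Ω), 0 ≤ a x) {SolD SolU : (ℝ → V Ω) → Prop}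
    (hD : ∀ u, SolD u → IsWeakSolution a u) (hU : ∀ u, SolU u → IsWeakSolution (fun _ => 0) u)
    (hDU : ∀ X ∈ trajectories Φ SolD, ∀ τ, ∃ Y ∈ trajectories Φ SolU, Y 0 = X τ)
    (hUD : ∀ Y ∈ trajectories Φ SolU, ∃ X ∈ trajectories Φ SolD, X 0 = Y 0) :
    Stabilization SolD ↔ Observability a SolU := by
  rw [stabilization_iff hΦ, observability_iff hΦ ha]
  refine stabilization_iff_observability (isSkew_waveOp (embed Φ))
    (injective_waveOp (injective_embed Φ hΩ) (denseRange_embed Φ))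
    (inner_dampOp_comm (inner_damp_comm ha))
    (fun x => by rw [inner_dampOp]; exact inner_damp_nonneg ha ha0 _) ?_ ?_ hDU hUD
  · rintro X ⟨u, hu, hX⟩
    exact (hD u hu).isMild hΦ ha hX
  · rintro X ⟨u, hu, hX⟩
    have h := (hU u hu).isMild hΦ (memLp_top_const 0) hX
    have h0 : ∀ t, dampOp (VE Ω) (damp (Ω := Ω) (memLp_top_const (0 : ℝ))) (X t) = 0 := fun t => by
      rw [dampOp_apply, damp_zero]
      rfl
    simpa only [h0, neg_zero] using h

/-- Existence of weak solutions with prescribed data. -/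
theorem exists_isWeakSolution
    (hΩ : IsOpen Ω) (hΦ : ∀ u, (Φ u : PiLp 2 (fun _ : Fin d => L2 Ω)) = gradL Ω u)
    {a : Rd d → ℝ} (ha : MemLp a ∞ (volume.restrict Ω)) (x : State Ω) :
    ∃ X ∈ trajectories Φ (IsWeakSolution a), X 0 = x := by
  obtain ⟨X, hX0, hX⟩ := exists_isMild (isSkew_waveOp (embed Φ))
    (injective_waveOp (injective_embed Φ hΩ) (denseRange_embed Φ))
    (dampOp (VE Ω) (damp ha)) x
  exact ⟨X, ⟨_, hX.isWeakSolution hΦ ha, (hX.represents ha).2⟩, hX0⟩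

end Strong

end HypStokes

end

theorem mainTheorem3 (d : ℕ) (hd : 2 ≤ d) (Ω : Set (HypStokes.Rd d))
    (hΩ_open : IsOpen Ω) (hΩ_conn : IsConnected Ω) (hΩ_bdd : Bornology.IsBounded Ω)
    (a : HypStokes.Rd d → ℝ) (ha : MemLp a ∞ (volume.restrict Ω))
    (ha_nonneg : ∀ᵐ x ∂(volume.restrict Ω), 0 ≤ a x) :
    -- strong solutions, on a domain that is regular enough
    (HypStokes.StokesRegular Ω →
      (HypStokes.Stabilization (HypStokes.IsStrongSolution (Ω := Ω) a) ↔
        HypStokes.Observability a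
          (HypStokes.IsStrongSolution (Ω := Ω) (fun _ => (0 : ℝ))))) ∧
    -- finite energy solutions
    (HypStokes.Stabilization (HypStokes.IsWeakSolution (Ω := Ω) a) ↔
      HypStokes.Observability a
        (HypStokes.IsWeakSolution (Ω := Ω) (fun _ => (0 : ℝ)))) := by
  -- Poincaré's inequality is used in a single coordinate direction, the first.
  obtain ⟨hcl, Φ, hΦ⟩ := HypStokes.exists_equiv_VE hΩ_bdd (⟨0, by omega⟩ : Fin d)
  have hcomp : CompleteSpace (HypStokes.VE Ω) := hcl.completeSpace_coe
  have h0 : MemLp (fun _ : HypStokes.Rd d => (0 : ℝ)) ∞ (volume.restrict Ω) := memLp_top_const 0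
  constructor
  · intro hreg
    exact HypStokes.stabilization_iff_observability_of_trajectories hΩ_open hΦ ha ha_nonneg
      (fun _ hu => hu.isWeakSolution ha) (fun _ hu => hu.isWeakSolution h0)
      (fun _ hX τ => hreg.exists_isStrongSolution hΩ_open hΦ ha h0 hX τ)
      (fun _ hY => hreg.exists_isStrongSolution hΩ_open hΦ h0 ha hY 0)
  · exact HypStokes.stabilization_iff_observability_of_trajectories hΩ_open hΦ ha ha_nonneg
      (fun _ hu => hu) (fun _ hu => hu)
      (fun X _ τ => HypStokes.exists_isWeakSolution hΩ_open hΦ h0 (X τ))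
      (fun Y _ => HypStokes.exists_isWeakSolution hΩ_open hΦ ha (Y 0))
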